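/- Let $\Omega\subset\mathbb{R}^2$ be a bounded domain with Lipschitz boundary, $\mathbf V=(H^1_0(\Omega))^2$, $Q=L^2_0(\Omega)$ (the functions of $L^2(\Omega)$ with mean value zero), and $$a(\mathbf u,\mathbf v)=\int_\Omega\nabla\mathbf u:\nabla\mathbf v,\qquad b(\mathbf v,q)=\int_\Omega(\nabla\cdot\mathbf v)\,q,\qquad r(\mathbf u,\mathbf v)=\int_\Omega\mathbf u\cdot\mathbf v .$$ Write $\|\mathbf v\|_1=(r(\mathbf v,\mathbf v)+a(\mathbf v,\mathbf v))^{1/2}$, let $\|\cdot\|_0$ be the $L^2(\Omega)$ norm, and $\|\mathbf w\|_{-1}=\sup\{r(\mathbf w,\mathbf g):\mathbf g\in\mathbf V,\ \|\mathbf g\|_1\le 1\}$. *Exact eigenpair.* $(\mathbf u,p,\lambda)\in\mathbf V\times Q\times\mathbb R$ with $r(\mathbf u,\mathbf u)=1$, $a(\mathbf u,\mathbf v)-b(\mathbf v,p)=\lambda r(\mathbf u,\mathbf v)$ for all $\mathbf v\in\mathbf V$, and $b(\mathbf u,q)=0$ for all $q\in Q$. *Local projection stabilized (LPS) discretization.*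 A mesh $\mathcal T_h$ of $\Omega$ (finitely many pairwise disjoint open cells $K\subset\Omega$ covering $\Omega$ up to a null set); a finite-dimensional space $V_h$ of functions that are continuous on $\overline\Omega$ and polynomial on each cell; for each $K$ a finite-dimensional space $D_h(K)\subset L^2(K)$ and a parameter $\alpha_K\ge 0$. Put $\mathbf V_h=V_h^2\cap\mathbf V$, $Q_h=V_h\cap Q$ and $S_h(p,q)=\sum_{K}\alpha_K(\kappa_K\nabla p,\kappa_K\nabla q)_{L^2(K)}$, where $\kappa_K=\mathrm{id}-\pi_K$ acts componentwise and $\pi_K$ is the $L^2(K)$-orthogonal projection onto $D_h(K)$. A discrete eigenpair is $(\mathbf u_h,p_h,\lambda_h)\in\mathbf V_h\times Q_h\times\mathbb R$ with $r(\mathbf u_h,\mathbf u_h)=1$, $a(\mathbf u_h,\mathbf v)-b(\mathbf v,p_h)=\lambda_h r(\mathbf u_h,\mathbf v)$ for all $\mathbf v\in\mathbf V_h$, and $b(\mathbf u_h,q)+S_h(p_h,q)=0$ for all $q\in Q_h$. *Source problem.* Given a discrete eigenpair, $(\tilde{\mathbf u},\tilde p)\in\mathbf V\times Q$ satisfies $a(\tilde{\mathbf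 u},\mathbf v)-b(\mathbf v,\tilde p)=\lambda_h r(\mathbf u_h,\mathbf v)$ for all $\mathbf v\in\mathbf V$ and $b(\tilde{\mathbf u},q)=0$ for all $q\in Q$; if $\tilde{\mathbf u}\neq0$, put $\tilde\lambda=a(\tilde{\mathbf u},\tilde{\mathbf u})/r(\tilde{\mathbf u},\tilde{\mathbf u})$. **Theorem.** (a) For every $\lambda$ there are constants $C,\delta>0$, depending only on $\Omega$ and $\lambda$, such that for every exact eigenpair $(\mathbf u,p,\lambda)$, every LPS discretization, every discrete eigenpair $(\mathbf u_h,p_h,\lambda_h)$ and every corresponding $(\tilde{\mathbf u},\tilde p)$, $$\|\mathbf u-\tilde{\mathbf u}\|_1+\|p-\tilde p\|_0\le C\big(\|\mathbf u-\mathbf u_h\|_{-1}+|\lambda-\lambda_h|\big),\tag{1}$$ and, if $\|\mathbf u-\mathbf u_h\|_{-1}+|\lambda-\lambda_h|\le\delta$, then $\tilde{\mathbf u}\ne0$ and $$|\tilde\lambda-\lambda|\le C\big(\|\mathbf u-\mathbf u_h\|_{-1}^2+|\lambda-\lambda_h|^2\big).\tag{2}$$ (b) Consequently, if $(\mathbf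 u,p,\lambda)$ is an exact eigenpair and $(\mathbf u_{h_n},p_{h_n},\lambda_{h_n})$ is a sequence of discrete eigenpairs of LPS discretizations that approximates it, in the sense that $\|\mathbf u-\mathbf u_{h_n}\|_{-1}\to0$ and $\lambda_{h_n}\to\lambda$, then there is a constant $C>0$ independent of $n$ such that for all $n$ (1) holds, and (2) holds whenever $\tilde{\mathbf u}_n\neq0$. -/

import Mathlib

open MeasureTheory Set Filter Topology
open scoped ContDiff NNReal

noncomputable section

namespace StokesLPS

/-- The Euclidean plane. -/
abbrev Plane := EuclideanSpace ℝ (Fin 2)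

/-- The classical partial derivative `∂f/∂x_j` at `x`. -/
def partialDeriv (j : Fin 2) (f : Plane → ℝ) (x : Plane) : ℝ :=
  fderiv ℝ f x (EuclideanSpace.single j 1)

/-- A bounded domain with Lipschitz boundary: open, connected, bounded, and near every boundary
point, in suitable Cartesian coordinates, the set of points above the graph of a Lipschitz
function. -/
structure IsBoundedLipschitzDomain (Ω : Set Plane) : Prop where
  isOpen : IsOpen Ω
  isConnected : IsConnected Ω
  isBounded : Bornology.IsBounded Ω
  lipschitz_boundary : ∀ x ∈ frontier Ω,
    ∃ (e : Plane ≃ᵃⁱ[ℝ] Plane) (γ : ℝ → ℝ) (L : ℝ≥0), LipschitzWith L γ ∧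
      ∃ U ∈ 𝓝 x, ∀ y ∈ U, (y ∈ Ω ↔ γ (e y 0) < e y 1)

/-- `L²(Ω)`. -/
abbrev L2 (Ω : Set Plane) := Lp ℝ 2 (volume.restrict Ω)

/-- Membership in `Q = L²₀(Ω)`, the functions of `L²(Ω)` with mean value
zero. It is used for bounded `Ω`, where functions of `L²(Ω)` are integrable. -/
def IsMeanZero {Ω : Set Plane} (p : L2 Ω) : Prop := ∫ x in Ω, p x = 0

/-- The pairs `(φ, ∇φ)` in `L²(Ω) × L²(Ω)²` where `φ` is a smooth function with compact support in
`Ω`. -/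
def testJets (Ω : Set Plane) : Submodule ℝ (L2 Ω × (Fin 2 → L2 Ω)) where
  carrier := {J | ∃ φ : Plane → ℝ, ContDiff ℝ ∞ φ ∧ HasCompactSupport φ ∧ tsupport φ ⊆ Ω ∧
    J.1 =ᵐ[volume.restrict Ω] φ ∧ ∀ j, J.2 j =ᵐ[volume.restrict Ω] partialDeriv j φ}
  zero_mem' := by
    refine ⟨0, contDiff_const, HasCompactSupport.zero, by simp [tsupport], ?_, fun j => ?_⟩
    · exact Lp.coeFn_zero _ _ _
    · refine (Lp.coeFn_zero _ _ _).trans (Eventually.of_forall fun x => ?_)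
      simp [partialDeriv]
  add_mem' := by
    rintro J K ⟨φ, hφ, hφc, hφs, h1, h2⟩ ⟨ψ, hψ, hψc, hψs, k1, k2⟩
    refine ⟨φ + ψ, hφ.add hψ, hφc.add hψc,
      (tsupport_add φ ψ).trans (union_subset hφs hψs), ?_, fun j => ?_⟩
    · exact (Lp.coeFn_add _ _).trans (h1.add k1)
    · refine (Lp.coeFn_add _ _).trans (((h2 j).add (k2 j)).trans (Eventually.of_forall fun x => ?_))
      simp [partialDeriv, fderiv_add (hφ.differentiable (by simp) x)
        (hψ.differentiable (by simp) x)]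
  smul_mem' := by
    rintro c J ⟨φ, hφ, hφc, hφs, h1, h2⟩
    refine ⟨c • φ, hφ.const_smul c, hφc.smul_left (f := fun _ => c),
      (tsupport_smul_subset_right (fun _ => c) φ).trans hφs, ?_, fun j => ?_⟩
    · exact (Lp.coeFn_smul _ _).trans (h1.const_smul c)
    · refine (Lp.coeFn_smul _ _).trans
        (((h2 j).const_smul c).trans (Eventually.of_forall fun x => ?_))
      simp [partialDeriv, fderiv_const_smul (hφ.differentiable (by simp) x)]

/-- `H¹₀(Ω)`, the closure of the test functions in the `H¹` norm. An element is stored together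
with its weak gradient, as the pair `(w, ∇w)` in `L²(Ω) × L²(Ω)²`; the weak gradient is determined
by `w`. -/
def H10 (Ω : Set Plane) : Submodule ℝ (L2 Ω × (Fin 2 → L2 Ω)) :=
  (testJets Ω).topologicalClosure

/-- The velocity space `𝐕 = (H¹₀(Ω))²`. -/
abbrev Velocity (Ω : Set Plane) := Fin 2 → H10 Ω

/-- The component `u_i`. -/
def Velocity.comp {Ω : Set Plane} (u : Velocity Ω) (i : Fin 2) : L2 Ω := (u i).1.1

/-- The weak derivative `∂u_i/∂x_j`. -/
def Velocity.grad {Ω : Set Plane} (u : Velocity Ω) (i j : Fin 2) : L2 Ω := (u i).1.2 j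

/-- `a(u, v) = ∫_Ω ∇u : ∇v`. -/
def aForm {Ω : Set Plane} (u v : Velocity Ω) : ℝ :=
  ∫ x in Ω, ∑ i, ∑ j, u.grad i j x * v.grad i j x

/-- `b(v, q) = ∫_Ω (div v) q`. -/
def bForm {Ω : Set Plane} (v : Velocity Ω) (q : Plane → ℝ) : ℝ :=
  ∫ x in Ω, (∑ i, v.grad i i x) * q x

/-- `r(u, v) = ∫_Ω u · v`. -/
def rForm {Ω : Set Plane} (u v : Velocity Ω) : ℝ :=
  ∫ x in Ω, ∑ i, u.comp i x * v.comp i x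

/-- The norm `‖u‖₁` of `(H¹(Ω))²`. -/
def norm1 {Ω : Set Plane} (u : Velocity Ω) : ℝ := √(rForm u u + aForm u u)

/-- The dual norm `‖w‖₋₁ = sup { r(w, g) : g ∈ (H¹₀(Ω))², ‖g‖₁ ≤ 1 }`. -/
def normNeg1 {Ω : Set Plane} (w : Velocity Ω) : ℝ :=
  sSup {t : ℝ | ∃ g : Velocity Ω, norm1 g ≤ 1 ∧ t = rForm w g}

/-- The Rayleigh quotient `a(w, w) / r(w, w)`. -/
def rayleigh {Ω : Set Plane} (w : Velocity Ω) : ℝ := aForm w w / rForm w w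

/-- `(u, p, lam)` is a solution of the weak Stokes eigenvalue problem, normalized in `L²`. -/
structure IsStokesEigen {Ω : Set Plane} (u : Velocity Ω) (p : L2 Ω) (lam : ℝ) : Prop where
  mean_zero : IsMeanZero p
  normalized : rForm u u = 1
  momentum : ∀ v : Velocity Ω, aForm u v - bForm v p = lam * rForm u v
  divergence : ∀ q : L2 Ω, IsMeanZero q → bForm u q = 0

/-- `(w, p)` is a solution of the weak Stokes source problem with load `c • f`. -/
structure IsStokesSource {Ω : Set Plane} (c : ℝ) (f : Velocity Ω) (w : Velocity Ω) (p : L2 Ω) :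
    Prop where
  mean_zero : IsMeanZero p
  momentum : ∀ v : Velocity Ω, aForm w v - bForm v p = c * rForm f v
  divergence : ∀ q : L2 Ω, IsMeanZero q → bForm w q = 0

/-- The data of a one-level local projection stabilization: a mesh of `Ω` into finitely many open
cells of any shape, a scalar finite element space `Vh` of continuous piecewise polynomials over the
mesh, on each cell `K` a finite-dimensional projection space `Dh K ⊆ L²(K)` (which may be zero),
and the stabilization parameters `α K`. -/
structure Discretization (Ω : Set Plane) where
  numCells : ℕ
  cell : Fin numCells → Set Plane
  isOpen_cell : ∀ K, IsOpen (cell K)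
  isBounded_cell : ∀ K, Bornology.IsBounded (cell K)
  cell_subset : ∀ K, cell K ⊆ Ω
  cell_disjoint : Pairwise fun K K' => Disjoint (cell K) (cell K')
  cell_cover : volume (Ω \ ⋃ K, cell K) = 0
  Vh : Submodule ℝ (Plane → ℝ)
  finite_Vh : Module.Finite ℝ Vh
  continuous_Vh : ∀ v ∈ Vh, ContinuousOn v (closure Ω)
  polynomial_Vh : ∀ v ∈ Vh, ∀ K, ∃ P : MvPolynomial (Fin 2) ℝ,
    ∀ x ∈ cell K, v x = MvPolynomial.eval (fun i => x i) P
  Dh : ∀ K, Submodule ℝ (L2 (cell K))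
  finite_Dh : ∀ K, Module.Finite ℝ (Dh K)
  α : Fin numCells → ℝ
  α_nonneg : ∀ K, 0 ≤ α K

theorem contDiff_eval (P : MvPolynomial (Fin 2) ℝ) :
    ContDiff ℝ ∞ (fun x : Plane => MvPolynomial.eval (fun i => x i) P) := by
  induction P using MvPolynomial.induction_on with
  | C a => simpa using contDiff_const
  | add p q hp hq => simpa using hp.add hq
  | mul_X p i hp =>
    simp only [map_mul, MvPolynomial.eval_X]
    exact hp.mul (by fun_prop)

namespace Discretization

variable {Ω : Set Plane} (D : Discretization Ω)

theorem memLp_partialDeriv (K : Fin D.numCells) (j : Fin 2) (v : D.Vh) :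
    MemLp (partialDeriv j (v : Plane → ℝ)) 2 (volume.restrict (D.cell K)) := by
  obtain ⟨P, hP⟩ := D.polynomial_Vh v v.2 K
  have hc : Continuous (partialDeriv j fun x : Plane => MvPolynomial.eval (fun i => x i) P) :=
    ((contDiff_eval P).continuous_fderiv (by simp)).clm_apply continuous_const
  have hcpt : IsCompact (closure (D.cell K)) := (D.isBounded_cell K).isCompact_closure
  have hfin : volume (D.cell K) ≠ ⊤ := (D.isBounded_cell K).measure_lt_top.ne
  have : IsFiniteMeasure (volume.restrict (D.cell K)) :=
    ⟨by simpa using (D.isBounded_cell K).measure_lt_top⟩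
  obtain ⟨M, hM⟩ := hcpt.exists_bound_of_continuousOn hc.continuousOn
  have h : MemLp (partialDeriv j fun x : Plane => MvPolynomial.eval (fun i => x i) P) 2
      (volume.restrict (D.cell K)) := by
    refine MemLp.of_bound hc.aestronglyMeasurable M ?_
    filter_upwards [ae_restrict_mem (D.isOpen_cell K).measurableSet] with x hx
    exact hM x (subset_closure hx)
  refine h.ae_eq ?_
  filter_upwards [ae_restrict_mem (D.isOpen_cell K).measurableSet] with x hx
  have : (v : Plane → ℝ) =ᶠ[𝓝 x] fun x : Plane => MvPolynomial.eval (fun i => x i) P := by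
    filter_upwards [(D.isOpen_cell K).mem_nhds hx] with y hy using hP y hy
  simp [partialDeriv, this.fderiv_eq]

/-- The restriction of `∂v/∂x_j` to the cell `K`, as an element of `L²(K)`. -/
def cellDeriv (K : Fin D.numCells) (j : Fin 2) (v : D.Vh) : L2 (D.cell K) :=
  (D.memLp_partialDeriv K j v).toLp _

/-- The fluctuation operator `id - π_K` on `L²(K)`, with `π_K` the `L²(K)`-orthogonal projection
onto `Dh K`. -/
def fluctuation (K : Fin D.numCells) (w : L2 (D.cell K)) : L2 (D.cell K) :=
  haveI := D.finite_Dh K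
  w - (D.Dh K).starProjection w

/-- The stabilization term `S_h(p, q) = ∑_K α_K (κ_h ∇p, κ_h ∇q)_K`. -/
def stab (p q : D.Vh) : ℝ :=
  ∑ K, D.α K * ∑ j,
    inner ℝ (D.fluctuation K (D.cellDeriv K j p)) (D.fluctuation K (D.cellDeriv K j q))

/-- Membership in the discrete velocity space `𝐕_h = V_h² ∩ 𝐕`. -/
def MemVelocity (v : Velocity Ω) : Prop :=
  ∀ i, ∃ w ∈ D.Vh, v.comp i =ᵐ[volume.restrict Ω] w

/-- Membership in the discrete pressure space `Q_h = V_h ∩ Q`. -/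
def MemPressure (q : D.Vh) : Prop := ∫ x in Ω, (q : Plane → ℝ) x = 0

/-- `(uh, ph, lamh)` is a solution of the discrete (stabilized) Stokes eigenvalue problem,
normalized in `L²`. -/
structure IsEigen (uh : Velocity Ω) (ph : D.Vh) (lamh : ℝ) : Prop where
  mem_velocity : D.MemVelocity uh
  mem_pressure : D.MemPressure ph
  normalized : rForm uh uh = 1
  momentum : ∀ v : Velocity Ω, D.MemVelocity v →
    aForm uh v - bForm v (ph : Plane → ℝ) = lamh * rForm uh v
  divergence : ∀ q : D.Vh, D.MemPressure q → bForm uh (q : Plane → ℝ) + D.stab ph q = 0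

end Discretization

end StokesLPS

end

/-!
The error `(u - ũ, p - p̃)` solves a Stokes problem whose load `λ u - λ_h u_h` has dual norm at most
a constant times `‖u - u_h‖₋₁ + |λ - λ_h|`, so that (1) is the stability of the Stokes problem,
which rests on the Poincaré inequality for the velocity and the inf-sup condition for the pressure.
The Rayleigh quotient is stationary at an eigenfunction, so its error is quadratic in `‖u - ũ‖₁`,
which is (2). Along a sequence all but finitely many indices fall under (2), and the others are
absorbed by the constant, because a vanishing right-hand side forces a vanishing error.

The inf-sup condition on a Lipschitz domain comes from Nečas' inequality: `‖p‖₀` is bounded by the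
`H⁻¹` norms of `∇p` and `p`. Near each point of its closure the domain is stable under translations
along a cone, and a weighted average of integrals over the rays of the cone inverts the divergence
locally up to a remainder. The `L²` bound for the gradient of this average needs no singular
integrals: after a partial Fourier transform along one axis it is Young's convolution inequality
with a kernel of `L¹` norm independent of the frequency. By Rellich's theorem, the `H⁻¹` norm of `p`
is absorbed on a subspace of finite codimension. Hence the weak gradient has closed range, and it is
injective on functions of mean zero because its kernel consists of the constants.
-/

noncomputable section

namespace StokesLPS

/-! ### Forms and norms -/

section Bilinear

variable {V : Type*} [AddCommGroup V] [Module ℝ V] {a r : LinearMap.BilinForm ℝ V} {u w : V}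
  {lam : ℝ}

theorem bilin_sub_self (hr : r.IsSymm) (u w : V) :
    r (u - w) (u - w) = r u u - 2 * r u w + r w w := by
  simp only [map_sub, LinearMap.sub_apply, hr.eq w u]
  ring

theorem bilin_sub_mul_eq_of_eigenvector (ha : a.IsSymm) (hr : r.IsSymm)
    (huu : a u u = lam * r u u) (huw : a u w = lam * r u w) :
    a w w - lam * r w w = a (u - w) (u - w) - lam * r (u - w) (u - w) := by
  rw [bilin_sub_self ha, bilin_sub_self hr]
  linarith

theorem quarter_le_bilin_self (hr : r.IsPosSemidef) (hu : r u u = 1)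
    (huw : r (u - w) (u - w) ≤ 1 / 4) : 1 / 4 ≤ r w w := by
  have cauchy_schwarz : r u w ^ 2 ≤ r w w := by
    simpa [hu] using LinearMap.BilinForm.apply_sq_le_of_symm r hr.nonneg
      (LinearMap.BilinForm.isSymm_iff.1 hr.isSymm) u w
  rw [bilin_sub_self hr.isSymm, hu] at huw
  nlinarith [sq_nonneg (r u w - 1 / 2)]

end Bilinear

section Forms

variable {Ω : Set Plane}

theorem inner_L2_eq_integral (f g : L2 Ω) : inner ℝ f g = ∫ x in Ω, f x * g x := by
  simp only [L2.inner_def, RCLike.inner_apply, conj_trivial, mul_comm]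

theorem integrable_mul_L2 (f g : L2 Ω) : Integrable (fun x => f x * g x) (volume.restrict Ω) :=
  (Lp.memLp f).integrable_mul (Lp.memLp g)

/-- The component `u ↦ u_i` as a linear map. -/
def compₗ (Ω : Set Plane) (i : Fin 2) : Velocity Ω →ₗ[ℝ] L2 Ω :=
  LinearMap.fst ℝ _ _ ∘ₗ (H10 Ω).subtype ∘ₗ LinearMap.proj i

/-- The weak derivative `u ↦ ∂u_i/∂x_j` as a linear map. -/
def gradₗ (Ω : Set Plane) (i j : Fin 2) : Velocity Ω →ₗ[ℝ] L2 Ω :=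
  LinearMap.proj j ∘ₗ LinearMap.snd ℝ _ _ ∘ₗ (H10 Ω).subtype ∘ₗ LinearMap.proj i

/-- `rForm` as a bilinear form. -/
def rBilin (Ω : Set Plane) : LinearMap.BilinForm ℝ (Velocity Ω) :=
  ∑ i, (innerₗ (L2 Ω)).compl₁₂ (compₗ Ω i) (compₗ Ω i)

/-- `aForm` as a bilinear form. -/
def aBilin (Ω : Set Plane) : LinearMap.BilinForm ℝ (Velocity Ω) :=
  ∑ i, ∑ j, (innerₗ (L2 Ω)).compl₁₂ (gradₗ Ω i j) (gradₗ Ω i j)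

/-- `bForm`, for pressures in `L²(Ω)`, as a bilinear map. -/
def bBilin (Ω : Set Plane) : Velocity Ω →ₗ[ℝ] L2 Ω →ₗ[ℝ] ℝ :=
  innerₗ (L2 Ω) ∘ₗ ∑ i, gradₗ Ω i i

theorem rBilin_apply (u v : Velocity Ω) :
    rBilin Ω u v = ∑ i, inner ℝ (u.comp i) (v.comp i) := by
  simp only [rBilin, LinearMap.sum_apply]
  rfl

theorem aBilin_apply (u v : Velocity Ω) :
    aBilin Ω u v = ∑ i, ∑ j, inner ℝ (u.grad i j) (v.grad i j) := by
  simp only [aBilin, LinearMap.sum_apply]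
  rfl

theorem bBilin_apply (v : Velocity Ω) (q : L2 Ω) :
    bBilin Ω v q = ∑ i, inner ℝ (v.grad i i) q := by
  rw [bBilin, LinearMap.comp_apply, LinearMap.sum_apply, map_sum, LinearMap.sum_apply]
  rfl

theorem rForm_eq_rBilin (u v : Velocity Ω) : rForm u v = rBilin Ω u v := by
  simp_rw [rBilin_apply, rForm, inner_L2_eq_integral]
  exact integral_finsetSum _ fun i _ => integrable_mul_L2 _ _

theorem aForm_eq_aBilin (u v : Velocity Ω) : aForm u v = aBilin Ω u v := by
  simp_rw [aBilin_apply, aForm, inner_L2_eq_integral]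
  rw [integral_finsetSum _ fun i _ => integrable_finsetSum _ fun j _ => integrable_mul_L2 _ _]
  exact Finset.sum_congr rfl fun i _ => integral_finsetSum _ fun j _ => integrable_mul_L2 _ _

theorem bForm_eq_bBilin (v : Velocity Ω) (q : L2 Ω) : bForm v q = bBilin Ω v q := by
  simp_rw [bBilin_apply, bForm, inner_L2_eq_integral, Finset.sum_mul]
  exact integral_finsetSum _ fun i _ => integrable_mul_L2 _ _

theorem rForm_self_eq (u : Velocity Ω) : rForm u u = ∑ i, ‖u.comp i‖ ^ 2 := by
  simp only [rForm_eq_rBilin, rBilin_apply, real_inner_self_eq_norm_sq]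

theorem aForm_self_eq (u : Velocity Ω) : aForm u u = ∑ i, ∑ j, ‖u.grad i j‖ ^ 2 := by
  simp only [aForm_eq_aBilin, aBilin_apply, real_inner_self_eq_norm_sq]

theorem rForm_self_nonneg (u : Velocity Ω) : 0 ≤ rForm u u := by
  rw [rForm_self_eq]; positivity

theorem aForm_self_nonneg (u : Velocity Ω) : 0 ≤ aForm u u := by
  rw [aForm_self_eq]; positivity

theorem isPosSemidef_rBilin (Ω : Set Plane) : (rBilin Ω).IsPosSemidef where
  eq u v := by simp only [rBilin_apply, real_inner_comm]
  nonneg u := (rForm_self_nonneg u).trans_eq (rForm_eq_rBilin u u)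

theorem isPosSemidef_aBilin (Ω : Set Plane) : (aBilin Ω).IsPosSemidef where
  eq u v := by simp only [aBilin_apply, real_inner_comm]
  nonneg u := (aForm_self_nonneg u).trans_eq (aForm_eq_aBilin u u)

theorem abs_rForm_le_sqrt_mul_sqrt (u v : Velocity Ω) :
    |rForm u v| ≤ √(rForm u u) * √(rForm v v) := by
  rw [← Real.sqrt_mul (rForm_self_nonneg u)]
  refine Real.abs_le_sqrt ?_
  simpa only [rForm_eq_rBilin] using LinearMap.BilinForm.apply_sq_le_of_symm _
    (isPosSemidef_rBilin Ω).nonneg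
    (LinearMap.BilinForm.isSymm_iff.1 (isPosSemidef_rBilin Ω).isSymm) u v

theorem abs_aForm_le_sqrt_mul_sqrt (u v : Velocity Ω) :
    |aForm u v| ≤ √(aForm u u) * √(aForm v v) := by
  rw [← Real.sqrt_mul (aForm_self_nonneg u)]
  refine Real.abs_le_sqrt ?_
  simpa only [aForm_eq_aBilin] using LinearMap.BilinForm.apply_sq_le_of_symm _
    (isPosSemidef_aBilin Ω).nonneg
    (LinearMap.BilinForm.isSymm_iff.1 (isPosSemidef_aBilin Ω).isSymm) u v

end Forms

section Norms

variable {Ω : Set Plane}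

theorem norm1_nonneg (u : Velocity Ω) : 0 ≤ norm1 u := Real.sqrt_nonneg _

theorem norm1_sq (u : Velocity Ω) : norm1 u ^ 2 = rForm u u + aForm u u :=
  Real.sq_sqrt (add_nonneg (rForm_self_nonneg u) (aForm_self_nonneg u))

theorem sqrt_rForm_le_norm1 (u : Velocity Ω) : √(rForm u u) ≤ norm1 u :=
  Real.sqrt_le_sqrt (le_add_of_nonneg_right (aForm_self_nonneg u))

theorem sqrt_aForm_le_norm1 (u : Velocity Ω) : √(aForm u u) ≤ norm1 u :=
  Real.sqrt_le_sqrt (le_add_of_nonneg_left (rForm_self_nonneg u))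

theorem abs_rForm_le (u v : Velocity Ω) : |rForm u v| ≤ √(rForm u u) * norm1 v :=
  (abs_rForm_le_sqrt_mul_sqrt u v).trans (by gcongr; exact sqrt_rForm_le_norm1 v)

theorem abs_aForm_le (u v : Velocity Ω) : |aForm u v| ≤ norm1 u * norm1 v :=
  (abs_aForm_le_sqrt_mul_sqrt u v).trans
    (mul_le_mul (sqrt_aForm_le_norm1 u) (sqrt_aForm_le_norm1 v) (Real.sqrt_nonneg _)
      (norm1_nonneg u))

theorem norm1_smul (c : ℝ) (u : Velocity Ω) : norm1 (c • u) = |c| * norm1 u := by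
  have h : rForm (c • u) (c • u) + aForm (c • u) (c • u) = c ^ 2 * (rForm u u + aForm u u) := by
    simp only [rForm_eq_rBilin, aForm_eq_aBilin, map_smul, LinearMap.smul_apply, smul_eq_mul]
    ring
  rw [norm1, h, Real.sqrt_mul (sq_nonneg c), Real.sqrt_sq_eq_abs, norm1]

theorem bddAbove_rForm_unitBall (w : Velocity Ω) :
    BddAbove {t : ℝ | ∃ g : Velocity Ω, norm1 g ≤ 1 ∧ t = rForm w g} := by
  refine ⟨√(rForm w w), ?_⟩
  rintro _ ⟨g, hg, rfl⟩
  exact (le_abs_self _).trans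
    ((abs_rForm_le w g).trans (mul_le_of_le_one_right (Real.sqrt_nonneg _) hg))

theorem normNeg1_nonneg (w : Velocity Ω) : 0 ≤ normNeg1 w := by
  refine le_csSup (bddAbove_rForm_unitBall w) ⟨0, ?_, ?_⟩
  · simpa using (norm1_smul 0 (0 : Velocity Ω)).trans_le (by simp)
  · simp [rForm_eq_rBilin]

theorem rForm_le_normNeg1_mul (w g : Velocity Ω) : rForm w g ≤ normNeg1 w * norm1 g := by
  rcases (norm1_nonneg g).eq_or_lt with hg | hg
  · simpa [← hg] using (le_abs_self _).trans (abs_rForm_le w g)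
  · have hunit : rForm w ((norm1 g)⁻¹ • g) ≤ normNeg1 w := by
      refine le_csSup (bddAbove_rForm_unitBall w) ⟨_, ?_, rfl⟩
      rw [norm1_smul, abs_of_pos (inv_pos.2 hg), inv_mul_cancel₀ hg.ne']
    rw [rForm_eq_rBilin, map_smul, smul_eq_mul, inv_mul_le_iff₀ hg, mul_comm,
      ← rForm_eq_rBilin] at hunit
    exact hunit

theorem abs_rForm_le_normNeg1_mul (w g : Velocity Ω) :
    |rForm w g| ≤ normNeg1 w * norm1 g := by
  refine abs_le'.2 ⟨rForm_le_normNeg1_mul w g, ?_⟩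
  have hneg := rForm_le_normNeg1_mul w ((-1 : ℝ) • g)
  rw [norm1_smul] at hneg
  simpa [rForm_eq_rBilin] using hneg

end Norms

/-- The Poincaré inequality on the velocity space, with constant `P`. -/
def PoincareInequality (Ω : Set Plane) (P : ℝ) : Prop :=
  ∀ v : Velocity Ω, norm1 v ^ 2 ≤ P * aForm v v

/-- The inf-sup condition for the pair `(𝐕, Q)`, with inf-sup constant `1 / β`: the functional
`b(·, p)` on `𝐕` controls `p ∈ Q`. -/
def InfSupCondition (Ω : Set Plane) (β : ℝ) : Prop :=
  ∀ (p : L2 Ω) (M : ℝ), IsMeanZero p → 0 ≤ M → (∀ v : Velocity Ω, bForm v p ≤ M * norm1 v) →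
    ‖p‖ ≤ β * M

/-! ### Averages over rays -/

section Fourier

open FourierTransform
open scoped ENNReal

theorem lintegral_enorm_sq_fourier {V : Type*} [NormedAddCommGroup V] [InnerProductSpace ℝ V]
    [FiniteDimensional ℝ V] [MeasurableSpace V] [BorelSpace V] {g : V → ℂ} (hg : ContDiff ℝ ∞ g)
    (hc : HasCompactSupport g) : ∫⁻ ξ, ‖𝓕 g ξ‖ₑ ^ 2 = ∫⁻ x, ‖g x‖ₑ ^ 2 := by
  have ofReal_integral (T : SchwartzMap V ℂ) :
      ENNReal.ofReal (∫ x, ‖T x‖ ^ 2) = ∫⁻ x, ‖T x‖ₑ ^ 2 := by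
    have hT := T.memLp 2 volume
    rw [ofReal_integral_eq_lintegral_ofReal ((memLp_two_iff_integrable_sq_norm hT.1).1 hT)
      (Eventually.of_forall fun x => by positivity)]
    exact lintegral_congr fun x => by rw [ENNReal.ofReal_pow (norm_nonneg _), ofReal_norm]
  have h := congrArg ENNReal.ofReal (SchwartzMap.integral_norm_sq_fourier (hc.toSchwartzMap hg))
  rwa [ofReal_integral, ofReal_integral, SchwartzMap.fourier_coe] at h

theorem lintegral_enorm_sq_fourier_ofReal {h : ℝ → ℝ} (hh : ContDiff ℝ ∞ h)
    (hc : HasCompactSupport h) :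
    ∫⁻ ξ, ‖𝓕 (fun x => (h x : ℂ)) ξ‖ₑ ^ 2 = ∫⁻ x, ‖h x‖ₑ ^ 2 := by
  refine (lintegral_enorm_sq_fourier (Complex.ofRealCLM.contDiff.comp hh)
    (hc.comp_left Complex.ofReal_zero)).trans (lintegral_congr fun x => ?_)
  simp [enorm]

theorem integrable_fourier {V : Type*} [NormedAddCommGroup V] [InnerProductSpace ℝ V]
    [FiniteDimensional ℝ V] [MeasurableSpace V] [BorelSpace V] {g : V → ℂ} (hg : ContDiff ℝ ∞ g)
    (hc : HasCompactSupport g) : Integrable (𝓕 g) :=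
  SchwartzMap.integrable (μ := volume) (𝓕 (hc.toSchwartzMap hg))

theorem enorm_fourier_eq_of_hasDerivAt {f g : ℝ → ℂ} (hf : Integrable f) (hg : Integrable g)
    (hfg : ∀ x, HasDerivAt f (g x) x) (ξ : ℝ) :
    ‖𝓕 g ξ‖ₑ = ENNReal.ofReal (2 * Real.pi) * (ENNReal.ofReal |ξ| * ‖𝓕 f ξ‖ₑ) := by
  have hderiv : deriv f = g := funext fun x => (hfg x).deriv
  have hfourier : 𝓕 g ξ = (2 * Real.pi * Complex.I * ξ) * 𝓕 f ξ := by
    simp only [← hderiv, Real.fourier_deriv hf (fun x => (hfg x).differentiableAt) (hderiv ▸ hg),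
      smul_eq_mul]
  have hfactor : ‖(2 * Real.pi * Complex.I * ξ : ℂ)‖ₑ =
      ENNReal.ofReal (2 * Real.pi) * ENNReal.ofReal |ξ| := by
    rw [← ENNReal.ofReal_mul (by positivity), ← ofReal_norm]
    simp [abs_of_pos Real.pi_pos]
  rw [hfourier, enorm_mul, hfactor, mul_assoc]

theorem sq_lintegral_mul_le {α : Type*} [MeasurableSpace α] {μ : Measure α} {k a : α → ℝ≥0∞}
    (hk : AEMeasurable k μ) (ha : AEMeasurable a μ) :
    (∫⁻ s, k s * a s ∂μ) ^ 2 ≤ (∫⁻ s, k s ∂μ) * ∫⁻ s, k s * a s ^ 2 ∂μ := by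
  have sqrt_mul_sqrt (s : α) : k s * a s = k s ^ (1 / 2 : ℝ) * (k s * a s ^ 2) ^ (1 / 2 : ℝ) := by
    rw [← ENNReal.mul_rpow_of_nonneg _ _ (by norm_num), ← mul_assoc, ← sq, ← mul_pow,
      ← ENNReal.rpow_two, ← ENNReal.rpow_mul]
    norm_num
  have holder : ∫⁻ s, k s * a s ∂μ ≤
      (∫⁻ s, k s ∂μ) ^ (1 / 2 : ℝ) * (∫⁻ s, k s * a s ^ 2 ∂μ) ^ (1 / 2 : ℝ) := by
    simp_rw [sqrt_mul_sqrt]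
    exact ENNReal.lintegral_mul_norm_pow_le hk (hk.mul (ha.pow_const 2)) (by norm_num)
      (by norm_num) (by norm_num)
  refine (pow_le_pow_left' holder 2).trans_eq ?_
  rw [mul_pow, ← ENNReal.rpow_two, ← ENNReal.rpow_two, ← ENNReal.rpow_mul, ← ENNReal.rpow_mul]
  norm_num

theorem lintegral_sq_average_translates_le {S G : Type*} [MeasurableSpace S] {ν : Measure S}
    [SFinite ν] [AddGroup G] [MeasurableSpace G] [MeasurableAdd₂ G] [MeasurableNeg G]
    {μ : Measure G} [SFinite μ] [μ.IsAddRightInvariant] {T : S → G} {k : S → ℝ≥0∞} {a : G → ℝ≥0∞}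
    (hT : Measurable T) (hk : Measurable k) (ha : Measurable a) :
    ∫⁻ y, (∫⁻ s, k s * a (y - T s) ∂ν) ^ 2 ∂μ ≤ (∫⁻ s, k s ∂ν) ^ 2 * ∫⁻ y, a y ^ 2 ∂μ := by
  have hmeas : Measurable fun z : G × S => k z.2 * a (z.1 - T z.2) ^ 2 := by fun_prop
  calc ∫⁻ y, (∫⁻ s, k s * a (y - T s) ∂ν) ^ 2 ∂μ
      ≤ ∫⁻ y, (∫⁻ s, k s ∂ν) * ∫⁻ s, k s * a (y - T s) ^ 2 ∂ν ∂μ :=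
        lintegral_mono fun y => sq_lintegral_mul_le hk.aemeasurable (by fun_prop)
    _ = (∫⁻ s, k s ∂ν) * ∫⁻ y, ∫⁻ s, k s * a (y - T s) ^ 2 ∂ν ∂μ :=
        lintegral_const_mul _ hmeas.lintegral_prod_right'
    _ = (∫⁻ s, k s ∂ν) * ∫⁻ s, ∫⁻ y, k s * a (y - T s) ^ 2 ∂μ ∂ν := by
        rw [lintegral_lintegral_swap hmeas.aemeasurable]
    _ = (∫⁻ s, k s ∂ν) * ∫⁻ s, k s * ∫⁻ y, a y ^ 2 ∂μ ∂ν := by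
        congr 1
        refine lintegral_congr fun s => ?_
        rw [lintegral_const_mul _ (by fun_prop),
          lintegral_sub_right_eq_self (fun y => a y ^ 2) (T s)]
    _ = (∫⁻ s, k s ∂ν) ^ 2 * ∫⁻ y, a y ^ 2 ∂μ := by
        rw [lintegral_mul_const _ hk, sq, mul_assoc]

theorem lintegral_abs_mul_comp_mul_le {k : ℝ → ℝ≥0∞} (hk : Measurable k) (ξ : ℝ) :
    ∫⁻ s, ENNReal.ofReal |ξ| * k (s * ξ) ≤ ∫⁻ s, k s := by
  rcases eq_or_ne ξ 0 with rfl | hξ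
  · simp
  · have hscale : ∫⁻ s, k (s * ξ) = ENNReal.ofReal |ξ⁻¹| * ∫⁻ s, k s := by
      rw [← lintegral_map hk (measurable_mul_const ξ), Real.map_volume_mul_right hξ,
        lintegral_smul_measure, smul_eq_mul]
    rw [lintegral_const_mul _ (by fun_prop), hscale, ← mul_assoc,
      ← ENNReal.ofReal_mul (abs_nonneg _), ← abs_mul, mul_inv_cancel₀ hξ]
    simp

theorem hasCompactSupport_slice {X Y E : Type*} [TopologicalSpace X] [TopologicalSpace Y]
    [R1Space X] [Zero E] {h : X × Y → E} (hh : HasCompactSupport h) (y : Y) :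
    HasCompactSupport fun x => h (x, y) := by
  refine HasCompactSupport.intro (hh.isCompact.image continuous_fst) fun x hx => ?_
  by_contra hne
  exact hx ⟨(x, y), subset_tsupport _ hne, rfl⟩

end Fourier

section RayAverage

open FourierTransform
open scoped ENNReal

/-- The measure `ds dt` on the parameters `(s, t)` of the points `s (t, 1)` with `s > 0`. -/
abbrev rayParam : Measure (ℝ × ℝ) := (volume.restrict (Ioi 0)).prod volume

/-- The average, with weight `w`, of the integrals of `g` over the rays issuing from `(x, y)` in the
directions `-(t, 1)`. -/
def rayAverage (w : ℝ → ℝ) (g : ℝ × ℝ → ℝ) (x y : ℝ) : ℝ :=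
  ∫ z, w z.2 * g (x - z.1 * z.2, y - z.1) ∂rayParam

/-- The integrand, as a function of `x` and `z = (s, t)`, of the Fourier integral in `x` of
`rayAverage w g x y`. -/
def rayFourierIntegrand (w : ℝ → ℝ) (g : ℝ × ℝ → ℝ) (ξ y x : ℝ) (z : ℝ × ℝ) : ℂ :=
  Real.fourierChar (-(x * ξ)) • ((w z.2 * g (x - z.1 * z.2, y - z.1) : ℝ) : ℂ)

variable {w : ℝ → ℝ} {f g : ℝ × ℝ → ℝ}

theorem continuous_rayFourierIntegrand (hw : Continuous w) (hg : Continuous g) (ξ y : ℝ) :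
    Continuous (Function.uncurry (rayFourierIntegrand w g ξ y)) := by
  simp only [rayFourierIntegrand, Function.uncurry_def, Circle.smul_def]
  fun_prop

theorem hasCompactSupport_rayFourierIntegrand (hw : HasCompactSupport w)
    (hg : HasCompactSupport g) (ξ y : ℝ) :
    HasCompactSupport (Function.uncurry (rayFourierIntegrand w g ξ y)) := by
  have hK : IsCompact ((fun q : ℝ × (ℝ × ℝ) =>
      (q.2.1 + (y - q.2.2) * q.1, (y - q.2.2, q.1))) '' (tsupport w ×ˢ tsupport g)) :=
    (hw.isCompact.prod hg.isCompact).image (by fun_prop)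
  refine HasCompactSupport.intro hK ?_
  rintro ⟨x, s, t⟩ hx
  by_contra hne
  refine hx ⟨(t, (x - s * t, y - s)), ⟨subset_tsupport _ ?_, subset_tsupport _ ?_⟩, ?_⟩
  · exact fun h0 => hne (by simp [Function.uncurry, rayFourierIntegrand, h0])
  · exact fun h0 => hne (by simp [Function.uncurry, rayFourierIntegrand, h0])
  · ext <;> simp

theorem integral_rayFourierIntegrand (w : ℝ → ℝ) (g : ℝ × ℝ → ℝ) (ξ y : ℝ) (z : ℝ × ℝ) :
    ∫ x, rayFourierIntegrand w g ξ y x z =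
      Real.fourierChar (-(z.2 * (z.1 * ξ))) • (w z.2 : ℂ) *
        𝓕 (fun x => (g (x, y - z.1) : ℂ)) ξ := by
  rw [Real.fourier_real_eq, ← integral_const_mul, ← integral_sub_right_eq_self
    (fun x => Real.fourierChar (-(z.2 * (z.1 * ξ))) • (w z.2 : ℂ) *
      Real.fourierChar (-(x * ξ)) • (g (x, y - z.1) : ℂ)) (z.1 * z.2)]
  congr 1 with x
  have hchar : Real.fourierChar (-(x * ξ)) =
      Real.fourierChar (-(z.2 * (z.1 * ξ))) * Real.fourierChar (-((x - z.1 * z.2) * ξ)) := by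
    rw [← AddChar.map_add_eq_mul]
    congr 1
    ring
  simp only [rayFourierIntegrand, hchar, Circle.smul_def, smul_eq_mul]
  push_cast
  ring

theorem fourier_rayAverage (hw : Continuous w) (hwc : HasCompactSupport w) (hg : Continuous g)
    (hgc : HasCompactSupport g) (ξ y : ℝ) :
    𝓕 (fun x => (rayAverage w g x y : ℂ)) ξ =
      ∫ s in Ioi 0, 𝓕 (fun t => (w t : ℂ)) (s * ξ) * 𝓕 (fun x => (g (x, y - s) : ℂ)) ξ := by
  set H := rayFourierIntegrand w g ξ y with hH
  have hcont : Continuous (Function.uncurry H) := continuous_rayFourierIntegrand hw hg ξ y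
  have hsupp : HasCompactSupport (Function.uncurry H) :=
    hasCompactSupport_rayFourierIntegrand hwc hgc ξ y
  have hint : Integrable (fun z => ∫ x, H x z) rayParam :=
    (hcont.integrable_of_hasCompactSupport hsupp (μ := volume.prod _)).integral_prod_right
  calc 𝓕 (fun x => (rayAverage w g x y : ℂ)) ξ
      = ∫ x, ∫ z, H x z ∂rayParam := by
        rw [Real.fourier_real_eq]
        congr 1 with x
        rw [rayAverage, ← integral_complex_ofReal]
        simp only [Circle.smul_def, smul_eq_mul, hH, rayFourierIntegrand]
        rw [integral_const_mul]
    _ = ∫ s in Ioi 0, ∫ t, ∫ x, H x (s, t) := by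
        rw [integral_integral_swap_of_hasCompactSupport hcont hsupp, integral_prod _ hint]
    _ = _ := by
        simp only [hH, integral_rayFourierIntegrand, integral_mul_const]
        simp only [← Real.fourier_real_eq]

theorem measurable_partialFourier (hf : Continuous f) :
    Measurable fun z : ℝ × ℝ => 𝓕 (fun x => (f (x, z.2) : ℂ)) z.1 := by
  have hc : Continuous fun q : (ℝ × ℝ) × ℝ =>
      Real.fourierChar (-(q.2 * q.1.1)) • (f (q.2, q.1.2) : ℂ) := by
    simp only [Circle.smul_def]
    fun_prop
  simp_rw [Real.fourier_real_eq]
  exact (hc.stronglyMeasurable.integral_prod_right' (ν := (volume : Measure ℝ))).measurable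

/-- The convolution kernel in `s` that bounds the Fourier transform in `x` of the ray average of an
`x`-derivative. The factor `|ξ|` of the derivative is absorbed by the scaling `s ↦ s ξ`, so that its
integral is bounded uniformly in `ξ`. -/
def rayKernel (w : ℝ → ℝ) (ξ s : ℝ) : ℝ≥0∞ :=
  ENNReal.ofReal (2 * Real.pi) * (ENNReal.ofReal |ξ| * ‖𝓕 (fun t => (w t : ℂ)) (s * ξ)‖ₑ)

theorem measurable_enorm_fourier (hw : Continuous w) :
    Measurable fun τ => ‖𝓕 (fun t => (w t : ℂ)) τ‖ₑ :=
  ((measurable_partialFourier (f := fun z => w z.1) (by fun_prop)).comp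
    (by fun_prop : Measurable fun τ : ℝ => (τ, (0 : ℝ)))).enorm

theorem measurable_rayKernel (hw : Continuous w) :
    Measurable fun z : ℝ × ℝ => rayKernel w z.1 z.2 :=
  ((measurable_fst.abs.ennreal_ofReal).mul ((measurable_enorm_fourier hw).comp
    (measurable_snd.mul measurable_fst))).const_mul _

theorem measurable_lintegral_rayKernel_mul (hw : Continuous w) {F : ℝ → ℝ → ℝ≥0∞}
    (hF : Measurable fun z : ℝ × ℝ => F z.1 z.2) :
    Measurable fun z : ℝ × ℝ => ∫⁻ s, rayKernel w z.1 s * F z.1 (z.2 - s) := by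
  have hk : Measurable fun q : (ℝ × ℝ) × ℝ => rayKernel w q.1.1 q.2 :=
    (measurable_rayKernel hw).comp (by fun_prop : Measurable fun q : (ℝ × ℝ) × ℝ => (q.1.1, q.2))
  have hFs : Measurable fun q : (ℝ × ℝ) × ℝ => F q.1.1 (q.1.2 - q.2) :=
    hF.comp (by fun_prop : Measurable fun q : (ℝ × ℝ) × ℝ => (q.1.1, q.1.2 - q.2))
  exact (hk.mul hFs).lintegral_prod_right'

theorem lintegral_rayKernel_le (hw : Continuous w) (ξ : ℝ) :
    ∫⁻ s, rayKernel w ξ s ≤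
      ENNReal.ofReal (2 * Real.pi) * ∫⁻ τ, ‖𝓕 (fun t => (w t : ℂ)) τ‖ₑ := by
  simp only [rayKernel]
  rw [lintegral_const_mul' _ _ ENNReal.ofReal_ne_top]
  exact mul_le_mul_right (lintegral_abs_mul_comp_mul_le (measurable_enorm_fourier hw) ξ) _

theorem enorm_fourier_rayAverage_deriv_le (hw : Continuous w) (hwc : HasCompactSupport w)
    (hf : Continuous f) (hfc : HasCompactSupport f) (hg : Continuous g)
    (hgc : HasCompactSupport g) (hfg : ∀ x y, HasDerivAt (fun x => f (x, y)) (g (x, y)) x)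
    (ξ y : ℝ) :
    ‖𝓕 (fun x => (rayAverage w g x y : ℂ)) ξ‖ₑ ≤
      ∫⁻ s, rayKernel w ξ s * ‖𝓕 (fun x => (f (x, y - s) : ℂ)) ξ‖ₑ := by
  have hint {h : ℝ × ℝ → ℝ} (hh : Continuous h) (hhc : HasCompactSupport h) (y : ℝ) :
      Integrable fun x => (h (x, y) : ℂ) :=
    ((hh.comp (by fun_prop : Continuous fun x : ℝ => (x, y))).integrable_of_hasCompactSupport
      (hasCompactSupport_slice hhc y)).ofReal
  rw [fourier_rayAverage hw hwc hg hgc]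
  refine (enorm_integral_le_lintegral_enorm _).trans ((setLIntegral_le_lintegral _ _).trans_eq ?_)
  refine lintegral_congr fun s => ?_
  rw [enorm_mul, enorm_fourier_eq_of_hasDerivAt (hint hf hfc _) (hint hg hgc _)
    fun x => (hfg x (y - s)).ofReal_comp, rayKernel]
  ring

theorem lintegral_rayAverage_deriv_sq_le (hw : Continuous w)
    (hwc : HasCompactSupport w) (hf : ContDiff ℝ ∞ f) (hfc : HasCompactSupport f)
    (hg : Continuous g) (hgc : HasCompactSupport g)
    (hfg : ∀ x y, HasDerivAt (fun x => f (x, y)) (g (x, y)) x)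
    (hA : ∀ y, ContDiff ℝ ∞ fun x => rayAverage w g x y)
    (hAc : ∀ y, HasCompactSupport fun x => rayAverage w g x y) :
    ∫⁻ y, ∫⁻ x, ‖rayAverage w g x y‖ₑ ^ 2 ≤
      (ENNReal.ofReal (2 * Real.pi) * ∫⁻ τ, ‖𝓕 (fun t => (w t : ℂ)) τ‖ₑ) ^ 2 *
        ∫⁻ y, ∫⁻ x, ‖f (x, y)‖ₑ ^ 2 := by
  set M := ENNReal.ofReal (2 * Real.pi) * ∫⁻ τ, ‖𝓕 (fun t => (w t : ℂ)) τ‖ₑ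
  set F : ℝ → ℝ → ℝ≥0∞ := fun ξ y => ‖𝓕 (fun x => (f (x, y) : ℂ)) ξ‖ₑ
  have hF : Measurable fun z : ℝ × ℝ => F z.1 z.2 :=
    (measurable_partialFourier hf.continuous).enorm
  calc ∫⁻ y, ∫⁻ x, ‖rayAverage w g x y‖ₑ ^ 2
      = ∫⁻ y, ∫⁻ ξ, ‖𝓕 (fun x => (rayAverage w g x y : ℂ)) ξ‖ₑ ^ 2 :=
        lintegral_congr fun y => (lintegral_enorm_sq_fourier_ofReal (hA y) (hAc y)).symm
    _ ≤ ∫⁻ y, ∫⁻ ξ, (∫⁻ s, rayKernel w ξ s * F ξ (y - s)) ^ 2 := by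
        gcongr with y ξ
        exact enorm_fourier_rayAverage_deriv_le hw hwc hf.continuous hfc hg hgc hfg ξ y
    _ = ∫⁻ ξ, ∫⁻ y, (∫⁻ s, rayKernel w ξ s * F ξ (y - s)) ^ 2 :=
        (lintegral_lintegral_swap
          ((measurable_lintegral_rayKernel_mul hw hF).pow_const 2).aemeasurable).symm
    _ ≤ ∫⁻ ξ, M ^ 2 * ∫⁻ y, F ξ y ^ 2 := by
        gcongr with ξ
        refine (lintegral_sq_average_translates_le measurable_id
          ((measurable_rayKernel hw).comp measurable_prodMk_left)
          (hF.comp measurable_prodMk_left)).trans ?_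
        exact mul_le_mul_left (pow_le_pow_left' (lintegral_rayKernel_le hw ξ) 2) _
    _ = M ^ 2 * ∫⁻ y, ∫⁻ ξ, F ξ y ^ 2 := by
        rw [lintegral_const_mul _ (hF.pow_const 2).lintegral_prod_right',
          lintegral_lintegral_swap (hF.pow_const 2).aemeasurable]
    _ = M ^ 2 * ∫⁻ y, ∫⁻ x, ‖f (x, y)‖ₑ ^ 2 := by
        congr 1
        exact lintegral_congr fun y => lintegral_enorm_sq_fourier_ofReal
          (hf.comp (contDiff_id.prodMk contDiff_const)) (hasCompactSupport_slice hfc y)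

end RayAverage

section RayOp

variable (L : Plane ≃ₗᵢ[ℝ] Plane)

/-- The axes of the Cartesian coordinate system given by `L`. -/
def axis (k : Fin 2) : Plane := L (EuclideanSpace.single k 1)

theorem inner_axis (k l : Fin 2) : inner ℝ (axis L k) (axis L l) = if k = l then 1 else 0 := by
  simp [axis, EuclideanSpace.inner_single_left, PiLp.single_apply]

@[simp] theorem norm_axis (k : Fin 2) : ‖axis L k‖ = 1 := by
  simp [axis]

/-- The direction `(t, 1)` in the coordinate system given by `L`. -/
def rayDir (t : ℝ) : Plane := t • axis L 0 + axis L 1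

theorem inner_smul_rayDir (s t : ℝ) : inner ℝ (axis L 1) (s • rayDir L t) = s := by
  simp [rayDir, inner_smul_right, inner_add_right, inner_axis]

theorem continuous_rayDir : Continuous (rayDir L) := by
  unfold rayDir; fun_prop

/-- `rayAverage` in the coordinate system given by `L`. -/
def rayOp (w : ℝ → ℝ) (F : Plane → ℝ) (x : Plane) : ℝ :=
  ∫ z, w z.2 * F (x - z.1 • rayDir L z.2) ∂rayParam

variable {L} {w : ℝ → ℝ} {F : Plane → ℝ}

theorem exists_of_rayOp_ne_zero {x : Plane} (h : rayOp L w F x ≠ 0) :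
    ∃ s t : ℝ, 0 < s ∧ w t ≠ 0 ∧ F (x - s • rayDir L t) ≠ 0 := by
  by_contra! hc
  have hpos : ∀ᵐ z ∂rayParam, 0 < z.1 :=
    Measure.quasiMeasurePreserving_fst.ae (ae_restrict_mem measurableSet_Ioi)
  refine h (integral_eq_zero_of_ae ?_)
  filter_upwards [hpos] with z hz
  by_cases hw : w z.2 = 0
  · simp [hw]
  · simp [hc z.1 z.2 hz hw]

theorem hasCompactSupport_rayOp_integrand (hw : HasCompactSupport w) (hF : HasCompactSupport F)
    (x : Plane) : HasCompactSupport fun z : ℝ × ℝ => w z.2 * F (x - z.1 • rayDir L z.2) := by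
  have hK : IsCompact ((fun q : ℝ × Plane => (inner ℝ (axis L 1) (x - q.2), q.1)) ''
      (tsupport w ×ˢ tsupport F)) :=
    (hw.isCompact.prod hF.isCompact).image (by fun_prop)
  refine HasCompactSupport.intro hK ?_
  rintro ⟨s, t⟩ hx
  by_contra hne
  refine hx ⟨(t, x - s • rayDir L t), ⟨subset_tsupport _ (left_ne_zero_of_mul hne),
    subset_tsupport _ (right_ne_zero_of_mul hne)⟩, ?_⟩
  simp only [sub_sub_cancel, inner_smul_rayDir]

theorem integrable_rayOp_integrand (hw : Continuous w) (hwc : HasCompactSupport w)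
    (hF : Continuous F) (hFc : HasCompactSupport F) (x : Plane) :
    Integrable (fun z : ℝ × ℝ => w z.2 * F (x - z.1 • rayDir L z.2)) rayParam := by
  refine Continuous.integrable_of_hasCompactSupport ?_ (hasCompactSupport_rayOp_integrand hwc hFc x)
  have := continuous_rayDir L
  fun_prop

variable (L w) in
/-- The measure on the plane with which `rayOp` is a convolution. -/
def rayMeasure : Measure Plane :=
  (rayParam.withDensity fun z => ENNReal.ofReal (w z.2)).map fun z => z.1 • rayDir L z.2

theorem measurable_rayPoint : Measurable fun z : ℝ × ℝ => z.1 • rayDir L z.2 := by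
  have := (continuous_rayDir L).measurable
  fun_prop

theorem isLocallyFiniteMeasure_rayMeasure (hw : Continuous w) (hwc : HasCompactSupport w) :
    IsLocallyFiniteMeasure (rayMeasure L w) := by
  suffices IsFiniteMeasureOnCompacts (rayMeasure L w) from
    isLocallyFiniteMeasure_of_isFiniteMeasureOnCompacts
  refine ⟨fun K hK => ?_⟩
  obtain ⟨M, hM⟩ := (hK.image (f := fun z : Plane => inner ℝ (axis L 1) z)
    (by fun_prop)).isBounded.subset_closedBall 0
  have hpre : (fun z : ℝ × ℝ => z.1 • rayDir L z.2) ⁻¹' K ⊆ Metric.closedBall 0 M ×ˢ univ :=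
    fun z hz => ⟨by simpa only [inner_smul_rayDir] using hM (mem_image_of_mem _ hz), mem_univ _⟩
  rw [rayMeasure, Measure.map_apply measurable_rayPoint hK.measurableSet]
  refine (measure_mono hpre).trans_lt ?_
  rw [withDensity_apply _ (measurableSet_closedBall.prod .univ), rayParam, ← Measure.prod_restrict,
    Measure.restrict_univ]
  calc ∫⁻ z : ℝ × ℝ, ENNReal.ofReal (w z.2)
        ∂((volume.restrict (Ioi 0)).restrict (Metric.closedBall 0 M)).prod volume
      = (∫⁻ _ in Metric.closedBall (0 : ℝ) M, 1 ∂volume.restrict (Ioi 0)) *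
          ∫⁻ t, ENNReal.ofReal (w t) := by
        rw [← lintegral_prod_mul aemeasurable_const hw.measurable.ennreal_ofReal.aemeasurable]
        simp only [one_mul]
    _ < ⊤ := by
        refine ENNReal.mul_lt_top ?_ ?_
        · rw [setLIntegral_one]
          exact (Measure.restrict_apply_le _ _).trans_lt measure_closedBall_lt_top
        · exact (lintegral_mono fun t => Real.ofReal_le_enorm _).trans_lt
            (hw.integrable_of_hasCompactSupport hwc).2

theorem rayOp_eq_convolution (hw0 : ∀ t, 0 ≤ w t) (hw : Continuous w) (hF : Continuous F) :
    rayOp L w F =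
      convolution (fun _ => (1 : ℝ)) F (ContinuousLinearMap.lsmul ℝ ℝ) (rayMeasure L w) := by
  ext x
  rw [convolution_def, rayMeasure, integral_map measurable_rayPoint.aemeasurable
    (Continuous.aestronglyMeasurable (by
      simp only [ContinuousLinearMap.lsmul_apply, one_smul]; fun_prop)),
    integral_withDensity_eq_integral_toReal_smul (by fun_prop)
      (Eventually.of_forall fun _ => ENNReal.ofReal_lt_top)]
  refine integral_congr_ae (Eventually.of_forall fun z => ?_)
  simp [ENNReal.toReal_ofReal (hw0 _)]

theorem contDiff_rayOp (hw0 : ∀ t, 0 ≤ w t) (hw : Continuous w) (hwc : HasCompactSupport w)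
    (hF : ContDiff ℝ ∞ F) (hFc : HasCompactSupport F) : ContDiff ℝ ∞ (rayOp L w F) := by
  have := isLocallyFiniteMeasure_rayMeasure (L := L) hw hwc
  rw [rayOp_eq_convolution hw0 hw hF.continuous]
  exact hFc.contDiff_convolution_right (n := ⊤) _ (locallyIntegrable_const _) hF

theorem contDiff_fderiv_apply (hF : ContDiff ℝ ∞ F) (v : Plane) :
    ContDiff ℝ ∞ fun y => fderiv ℝ F y v :=
  (hF.fderiv_right (m := ∞) (by simp)).clm_apply contDiff_const

theorem fderiv_rayOp_apply (hw0 : ∀ t, 0 ≤ w t) (hw : Continuous w) (hwc : HasCompactSupport w)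
    (hF : ContDiff ℝ ∞ F) (hFc : HasCompactSupport F) (x v : Plane) :
    fderiv ℝ (rayOp L w F) x v = rayOp L w (fun y => fderiv ℝ F y v) x := by
  have := isLocallyFiniteMeasure_rayMeasure (L := L) hw hwc
  have hfderiv (y : Plane) : fderiv ℝ (fun q : ℝ × Plane => F q.2) (0, y) =
      (fderiv ℝ F y).comp (ContinuousLinearMap.snd ℝ ℝ Plane) :=
    ((hF.differentiable (by simp) y).hasFDerivAt.comp ((0 : ℝ), y) hasFDerivAt_snd).fderiv
  -- `HasCompactSupport.hasFDerivAt_convolution_right` asks for an invariant measure, which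
  -- `rayMeasure` is not; the version with a parameter does not, so a dummy parameter is added.
  have hparam := hasFDerivAt_convolution_right_with_param (μ := rayMeasure L w)
    (ContinuousLinearMap.lsmul ℝ ℝ) (f := fun _ : Plane => (1 : ℝ)) (g := fun _ : ℝ => F)
    (s := univ) isOpen_univ hFc.isCompact (fun _ y _ hy => image_eq_zero_of_notMem_tsupport hy)
    (locallyIntegrable_const _) ((hF.comp contDiff_snd).of_le (by simp)).contDiffOn (0, x)
    (mem_univ _)
  have hconv := (hparam.comp x ((hasFDerivAt_const (0 : ℝ) x).prodMk (hasFDerivAt_id x))).fderiv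
  rw [rayOp_eq_convolution hw0 hw hF.continuous,
    rayOp_eq_convolution hw0 hw (contDiff_fderiv_apply hF v).continuous]
  refine (DFunLike.congr_fun hconv v).trans ?_
  rw [ContinuousLinearMap.comp_apply, convolution_precompR_apply _ (locallyIntegrable_const _)]
  · simp [Function.HasUncurry.uncurry, hfderiv]
  · simp only [Function.HasUncurry.uncurry, id, hfderiv]
    exact (hFc.fderiv ℝ).comp_left (g := fun A : Plane →L[ℝ] ℝ =>
      A.comp (ContinuousLinearMap.snd ℝ ℝ Plane)) (by simp)
  · simp only [Function.HasUncurry.uncurry, id, hfderiv]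
    exact (hF.continuous_fderiv (by simp)).clm_comp continuous_const

theorem integral_Ioi_fderiv_rayDir (hF : ContDiff ℝ ∞ F) (hFc : HasCompactSupport F) (x : Plane)
    (t : ℝ) :
    ∫ s in Ioi (0 : ℝ), fderiv ℝ F (x - s • rayDir L t) (rayDir L t) = F x := by
  have hderiv (s : ℝ) : HasDerivAt (fun s : ℝ => F (x - s • rayDir L t))
      (-(fderiv ℝ F (x - s • rayDir L t) (rayDir L t))) s := by
    have hline : HasDerivAt (fun s : ℝ => x - s • rayDir L t) (-(rayDir L t)) s := by
      simpa using ((hasDerivAt_id s).smul_const (rayDir L t)).const_sub x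
    rw [← map_neg]
    exact (hF.differentiable (by simp) _).hasFDerivAt.comp_hasDerivAt s hline
  have hsupp : HasCompactSupport fun s : ℝ => F (x - s • rayDir L t) := by
    refine HasCompactSupport.intro (hFc.isCompact.image
      (f := fun y => inner ℝ (axis L 1) (x - y)) (by fun_prop)) fun s hs => ?_
    by_contra hne
    exact hs ⟨x - s • rayDir L t, subset_tsupport _ hne, by
      simp only [sub_sub_cancel, inner_smul_rayDir]⟩
  have hsmooth : ContDiff ℝ 1 fun s : ℝ => F (x - s • rayDir L t) :=
    (hF.of_le (by simp)).comp (by fun_prop)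
  have hftc := hsupp.integral_Ioi_deriv_eq hsmooth 0
  simpa only [(hderiv _).deriv, integral_neg, neg_inj, zero_smul, sub_zero] using hftc

theorem rayOp_fderiv_add (hw : Continuous w) (hwc : HasCompactSupport w)
    (hF : ContDiff ℝ ∞ F) (hFc : HasCompactSupport F) (x : Plane) :
    rayOp L (fun t => t * w t) (fun y => fderiv ℝ F y (axis L 0)) x +
      rayOp L w (fun y => fderiv ℝ F y (axis L 1)) x = (∫ t, w t) * F x := by
  have hint0 := integrable_rayOp_integrand (L := L) (by fun_prop : Continuous fun t => t * w t)
    hwc.mul_left (contDiff_fderiv_apply hF (axis L 0)).continuous (hFc.fderiv_apply ℝ _) x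
  have hint1 := integrable_rayOp_integrand (L := L) hw hwc
    (contDiff_fderiv_apply hF (axis L 1)).continuous (hFc.fderiv_apply ℝ _) x
  have hint : Integrable (fun z : ℝ × ℝ =>
      z.2 * w z.2 * fderiv ℝ F (x - z.1 • rayDir L z.2) (axis L 0) +
        w z.2 * fderiv ℝ F (x - z.1 • rayDir L z.2) (axis L 1)) rayParam := hint0.add hint1
  rw [rayOp, rayOp, ← integral_add hint0 hint1, integral_prod_symm _ hint, ← integral_mul_const]
  congr 1 with t
  rw [← integral_Ioi_fderiv_rayDir (L := L) hF hFc x t, ← integral_const_mul]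
  congr 1 with s
  simp only [rayDir, map_add, map_smul, smul_eq_mul]
  ring

variable (L) in
/-- The parametrization of the plane by the coordinates given by `L`. -/
def chart (z : ℝ × ℝ) : Plane := z.1 • axis L 0 + z.2 • axis L 1

theorem contDiff_chart : ContDiff ℝ ∞ (chart L) := by
  unfold chart; fun_prop

theorem hasDerivAt_chart (x y : ℝ) : HasDerivAt (fun x => chart L (x, y)) (axis L 0) x := by
  simpa [chart] using ((hasDerivAt_id x).smul_const (axis L 0)).add_const (y • axis L 1)

theorem hasCompactSupport_comp_chart (hF : HasCompactSupport F) :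
    HasCompactSupport fun z => F (chart L z) := by
  refine HasCompactSupport.intro (hF.isCompact.image
    (f := fun y => (inner ℝ (axis L 0) y, inner ℝ (axis L 1) y)) (by fun_prop)) fun z hz => ?_
  by_contra hne
  refine hz ⟨chart L z, subset_tsupport _ hne, ?_⟩
  simp [chart, inner_add_right, inner_smul_right, inner_axis]

theorem chart_eq_toLp (z : ℝ × ℝ) : chart L z = L (WithLp.toLp 2 ![z.1, z.2]) := by
  rw [chart, axis, axis, ← map_smul, ← map_smul, ← map_add]
  congr 1
  ext i
  fin_cases i <;> simp

theorem measurePreserving_chart : MeasurePreserving (chart L) := by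
  have h : MeasurePreserving (fun z : ℝ × ℝ => L (WithLp.toLp 2
      (MeasurableEquiv.finTwoArrow.symm z))) :=
    L.measurePreserving.comp ((PiLp.volume_preserving_toLp (Fin 2)).comp
      (volume_preserving_finTwoArrow ℝ).symm)
  convert h using 2 with z
  exact chart_eq_toLp z

theorem eLpNorm_two_sq {α : Type*} [MeasurableSpace α] (μ : Measure α) (f : α → ℝ) :
    eLpNorm f 2 μ ^ 2 = ∫⁻ x, ‖f x‖ₑ ^ 2 ∂μ := by
  simpa using eLpNorm_nnreal_pow_eq_lintegral (f := f) (μ := μ) (p := 2) (by norm_num)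

theorem eLpNorm_two_sq_eq_lintegral_chart (hF : Continuous F) :
    eLpNorm F 2 volume ^ 2 = ∫⁻ y, ∫⁻ x, ‖F (chart L (x, y))‖ₑ ^ 2 := by
  have hsq : Measurable fun x => ‖F x‖ₑ ^ 2 := hF.measurable.enorm.pow_const 2
  rw [eLpNorm_two_sq, ← (measurePreserving_chart (L := L)).lintegral_comp hsq]
  exact lintegral_prod_symm _ (hsq.comp contDiff_chart.continuous.measurable).aemeasurable

theorem rayOp_chart (x y : ℝ) : rayOp L w F (chart L (x, y)) =
    rayAverage w (fun z => F (chart L z)) x y := by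
  rw [rayOp, rayAverage]
  congr 1 with z
  congr 2
  simp only [chart, rayDir]
  module

theorem hasCompactSupport_rayOp_chart (hw : HasCompactSupport w) (hF : HasCompactSupport F)
    (y : ℝ) : HasCompactSupport fun x => rayOp L w F (chart L (x, y)) := by
  refine HasCompactSupport.intro (K := (fun q : ℝ × Plane => inner ℝ (axis L 0) q.2 +
    (y - inner ℝ (axis L 1) q.2) * q.1) '' (tsupport w ×ˢ tsupport F))
    ((hw.isCompact.prod hF.isCompact).image (by fun_prop)) fun x hx => ?_
  by_contra hne
  obtain ⟨s, t, -, hwt, hFx⟩ := exists_of_rayOp_ne_zero hne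
  refine hx ⟨(t, chart L (x, y) - s • rayDir L t),
    ⟨subset_tsupport _ hwt, subset_tsupport _ hFx⟩, ?_⟩
  simp [chart, rayDir, inner_sub_right, inner_add_right, inner_smul_right, inner_axis]

theorem exists_eLpNorm_fderiv_rayOp_axis_zero_le (L : Plane ≃ₗᵢ[ℝ] Plane) (hw0 : ∀ t, 0 ≤ w t)
    (hw : ContDiff ℝ ∞ w) (hwc : HasCompactSupport w) :
    ∃ C : ℝ≥0, ∀ F : Plane → ℝ, ContDiff ℝ ∞ F → HasCompactSupport F →
      eLpNorm (fun x => fderiv ℝ (rayOp L w F) x (axis L 0)) 2 volume ≤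
        C * eLpNorm F 2 volume := by
  set M := ENNReal.ofReal (2 * Real.pi) *
    ∫⁻ ξ, ‖FourierTransform.fourier (fun t => (w t : ℂ)) ξ‖ₑ
  have hM : M ≠ ⊤ := (ENNReal.mul_lt_top ENNReal.ofReal_lt_top
    (integrable_fourier (Complex.ofRealCLM.contDiff.comp hw)
      (hwc.comp_left Complex.ofReal_zero)).2).ne
  refine ⟨M.toNNReal, fun F hF hFc => ?_⟩
  set G : Plane → ℝ := fun y => fderiv ℝ F y (axis L 0)
  have hG : ContDiff ℝ ∞ G := contDiff_fderiv_apply hF _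
  have hGc : HasCompactSupport G := hFc.fderiv_apply ℝ _
  have hop : ContDiff ℝ ∞ (rayOp L w G) := contDiff_rayOp hw0 hw.continuous hwc hG hGc
  have hderiv (x y : ℝ) : HasDerivAt (fun x => F (chart L (x, y))) (G (chart L (x, y))) x :=
    (hF.differentiable (by simp) _).hasFDerivAt.comp_hasDerivAt x (hasDerivAt_chart x y)
  have key := lintegral_rayAverage_deriv_sq_le (w := w) (f := fun z => F (chart L z))
    (g := fun z => G (chart L z)) hw.continuous hwc (hF.comp contDiff_chart)
    (hasCompactSupport_comp_chart hFc) (hG.continuous.comp contDiff_chart.continuous)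
    (hasCompactSupport_comp_chart hGc) hderiv
  simp_rw [← rayOp_chart] at key
  specialize key (fun y => hop.comp (contDiff_chart.comp (contDiff_id.prodMk contDiff_const)))
    (fun y => hasCompactSupport_rayOp_chart hwc hGc y)
  have hfderiv (x : Plane) : fderiv ℝ (rayOp L w F) x (axis L 0) = rayOp L w G x :=
    fderiv_rayOp_apply hw0 hw.continuous hwc hF hFc x _
  simp_rw [hfderiv]
  rw [← ENNReal.pow_le_pow_left_iff two_ne_zero, ENNReal.coe_toNNReal hM, mul_pow,
    eLpNorm_two_sq_eq_lintegral_chart (L := L) hop.continuous,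
    eLpNorm_two_sq_eq_lintegral_chart (L := L) hF.continuous]
  exact key

end RayOp

/-! ### A local right inverse of the divergence -/

theorem fderiv_apply_eq_sum_partialDeriv (f : Plane → ℝ) (x v : Plane) :
    fderiv ℝ f x v = ∑ i, v i * partialDeriv i f x := by
  have hv : ∑ i, v i • EuclideanSpace.single i (1 : ℝ) = v := by
    simpa using (EuclideanSpace.basisFun (Fin 2) ℝ).sum_repr v
  conv_lhs => rw [← hv, map_sum]
  simp only [map_smul, smul_eq_mul, partialDeriv]

/-- Test functions: smooth functions with compact support contained in `U`, which need not be
open. -/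
structure IsTest (U : Set Plane) (f : Plane → ℝ) : Prop where
  contDiff : ContDiff ℝ ∞ f
  hasCompactSupport : HasCompactSupport f
  tsupport_subset : tsupport f ⊆ U

namespace IsTest

variable {U : Set Plane} {f g : Plane → ℝ}

theorem mono {V : Set Plane} (h : IsTest U f) (hUV : U ⊆ V) : IsTest V f :=
  ⟨h.1, h.2, h.3.trans hUV⟩

theorem zero (U : Set Plane) : IsTest U fun _ => 0 :=
  ⟨contDiff_const, HasCompactSupport.zero, by simp [tsupport]⟩

theorem add (hf : IsTest U f) (hg : IsTest U g) : IsTest U fun x => f x + g x :=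
  ⟨hf.1.add hg.1, hf.2.add hg.2, (tsupport_add f g).trans (union_subset hf.3 hg.3)⟩

theorem const_mul (hf : IsTest U f) (c : ℝ) : IsTest U fun x => c * f x :=
  ⟨contDiff_const.mul hf.1, hf.2.mul_left, (tsupport_mul_subset_right (f := fun _ => c)).trans hf.3⟩

theorem sum {ι : Type*} (s : Finset ι) {f : ι → Plane → ℝ} (hf : ∀ i, IsTest U (f i)) :
    IsTest U fun x => ∑ i ∈ s, f i x := by
  induction s using Finset.cons_induction with
  | empty => simpa using zero U
  | cons i s hi ih => simpa only [Finset.sum_cons] using (hf i).add ih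

theorem fderiv_apply (hf : IsTest U f) (v : Plane) : IsTest U fun x => fderiv ℝ f x v :=
  ⟨contDiff_fderiv_apply hf.1 v, hf.2.fderiv_apply ℝ v,
    (tsupport_fderiv_apply_subset ℝ v).trans hf.3⟩

theorem partialDeriv (hf : IsTest U f) (j : Fin 2) : IsTest U (partialDeriv j f) :=
  hf.fderiv_apply _

theorem fderiv_sum_const_mul {ι : Type*} {s : Finset ι} {f : ι → Plane → ℝ}
    (hf : ∀ i, IsTest U (f i)) (c : ι → ℝ) (x v : Plane) :
    fderiv ℝ (fun x => ∑ i ∈ s, c i * f i x) x v = ∑ i ∈ s, c i * fderiv ℝ (f i) x v := by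
  have hd (i : ι) : DifferentiableAt ℝ (f i) x := (hf i).1.differentiable (by simp) x
  rw [fderiv_fun_sum fun i _ => (hd i).const_mul (c i)]
  simp [fderiv_const_mul (hd _)]

end IsTest

theorem eLpNorm_sum_const_mul_le {α ι : Type*} [MeasurableSpace α] {μ : Measure α}
    {p : ENNReal} (hp : 1 ≤ p) (s : Finset ι) (c : ι → ℝ) {f : ι → α → ℝ}
    (hf : ∀ i, AEStronglyMeasurable (f i) μ) :
    eLpNorm (fun x => ∑ i ∈ s, c i * f i x) p μ ≤ ∑ i ∈ s, ‖c i‖ₑ * eLpNorm (f i) p μ := by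
  have hsum : (fun x => ∑ i ∈ s, c i * f i x) = ∑ i ∈ s, c i • f i := by
    ext x; simp
  rw [hsum]
  refine (eLpNorm_sum_le (fun i _ => (hf i).const_smul (c i)) hp).trans_eq ?_
  simp only [eLpNorm_const_smul]

theorem eLpNorm_mul_le_of_norm_le {α : Type*} [MeasurableSpace α] {μ : Measure α} {a : α → ℝ}
    {M : ℝ} (ha : ∀ x, ‖a x‖ ≤ M) (f : α → ℝ) (p : ENNReal) :
    eLpNorm (fun x => a x * f x) p μ ≤ M.toNNReal * eLpNorm f p μ :=
  eLpNorm_le_mul_eLpNorm_of_ae_le_mul (Eventually.of_forall fun x =>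
    (norm_mul _ _).trans_le (mul_le_mul_of_nonneg_right (ha x) (norm_nonneg _))) p

theorem IsTest.fderiv_mul_apply {U : Set Plane} {χ f : Plane → ℝ} (hχ : IsTest U χ)
    (hf : Differentiable ℝ f) (v x : Plane) :
    fderiv ℝ (fun x => χ x * f x) x v =
      fderiv ℝ χ x v * U.indicator f x + χ x * fderiv ℝ f x v := by
  have hind : fderiv ℝ χ x v * U.indicator f x = fderiv ℝ χ x v * f x := by
    by_cases hx : x ∈ U
    · rw [indicator_of_mem hx]
    · rw [image_eq_zero_of_notMem_tsupport (f := fun x => fderiv ℝ χ x v)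
        fun h => hx ((hχ.fderiv_apply v).3 h), zero_mul, zero_mul]
  rw [fderiv_fun_mul (hχ.1.differentiable (by simp) x) (hf x), hind]
  simp only [add_apply, smul_apply, smul_eq_mul]
  ring

section LocalSolver

variable {L : Plane ≃ₗᵢ[ℝ] Plane} {τ : ℝ} {w : ℝ → ℝ}

/-- A smooth nonnegative weight on the slopes of the rays that vanishes outside `[0, τ]`. -/
structure IsRayWeight (τ : ℝ) (w : ℝ → ℝ) : Prop where
  nonneg : ∀ t, 0 ≤ w t
  contDiff : ContDiff ℝ ∞ w
  mem_Icc : ∀ t, w t ≠ 0 → t ∈ Icc 0 τ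

theorem IsRayWeight.hasCompactSupport (hw : IsRayWeight τ w) : HasCompactSupport w :=
  HasCompactSupport.intro isCompact_Icc fun t ht => not_imp_comm.1 (hw.mem_Icc t) ht

theorem IsRayWeight.id_mul (hw : IsRayWeight τ w) : IsRayWeight τ fun t => t * w t where
  nonneg t := by
    by_cases h : w t = 0
    · simp [h]
    · exact mul_nonneg (hw.mem_Icc t h).1 (hw.nonneg t)
  contDiff := contDiff_id.mul hw.contDiff
  mem_Icc t ht := hw.mem_Icc t (right_ne_zero_of_mul ht)

theorem exists_isRayWeight (hτ : 0 < τ) : ∃ w, IsRayWeight τ w ∧ ∫ t, w t = 1 := by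
  let b : ContDiffBump (τ / 2) := ⟨τ / 8, τ / 4, by positivity, by linarith⟩
  refine ⟨b.normed volume, ⟨b.nonneg_normed, b.contDiff_normed, fun t ht => ?_⟩, b.integral_normed⟩
  have hball : t ∈ Metric.ball (τ / 2) (τ / 4) := by
    have : t ∈ Function.support (b.normed volume) := ht
    rwa [b.support_normed_eq] at this
  rw [Metric.mem_ball, Real.dist_eq, abs_lt] at hball
  constructor <;> linarith

theorem IsRayWeight.contDiff_rayOp (hw : IsRayWeight τ w) {U : Set Plane} {F : Plane → ℝ}
    (hF : IsTest U F) : ContDiff ℝ ∞ (rayOp L w F) :=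
  StokesLPS.contDiff_rayOp hw.nonneg hw.contDiff.continuous hw.hasCompactSupport hF.1 hF.2

theorem IsRayWeight.fderiv_rayOp (hw : IsRayWeight τ w) {U : Set Plane} {F : Plane → ℝ}
    (hF : IsTest U F) (x v : Plane) :
    fderiv ℝ (rayOp L w F) x v = rayOp L w (fun y => fderiv ℝ F y v) x :=
  fderiv_rayOp_apply hw.nonneg hw.contDiff.continuous hw.hasCompactSupport hF.1 hF.2 x v

theorem le_two_mul_of_ray_mem_closedBall {x₀ x : Plane} {r s t : ℝ}
    (hx : x ∈ Metric.closedBall x₀ r) (hy : x - s • rayDir L t ∈ Metric.closedBall x₀ r) :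
    s ≤ 2 * r := by
  calc s = inner ℝ (axis L 1) (s • rayDir L t) := (inner_smul_rayDir L s t).symm
    _ ≤ ‖axis L 1‖ * ‖s • rayDir L t‖ := real_inner_le_norm _ _
    _ = dist x (x - s • rayDir L t) := by rw [norm_axis, one_mul, dist_eq_norm, sub_sub_cancel]
    _ ≤ dist x x₀ + dist (x - s • rayDir L t) x₀ := dist_triangle_right _ _ _
    _ ≤ 2 * r := by linarith [Metric.mem_closedBall.1 hx, Metric.mem_closedBall.1 hy]

theorem exists_eLpNorm_indicator_rayOp_le (L : Plane ≃ₗᵢ[ℝ] Plane) (hw : Continuous w)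
    (hwc : HasCompactSupport w) (x₀ : Plane) (r : ℝ) :
    ∃ C : ℝ≥0, ∀ F : Plane → ℝ, Continuous F → tsupport F ⊆ Metric.closedBall x₀ r →
      eLpNorm ((Metric.closedBall x₀ r).indicator (rayOp L w F)) 2 volume ≤
        C * eLpNorm F 2 volume := by
  set k : ℝ × ℝ → ENNReal := fun z => (Iic (2 * r)).indicator 1 z.1 * ‖w z.2‖ₑ
  have hk : Measurable k :=
    ((measurable_one.indicator measurableSet_Iic).comp measurable_fst).mul
      (hw.measurable.enorm.comp measurable_snd)
  have hk_fin : ∫⁻ z, k z ∂rayParam ≠ ⊤ := by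
    rw [rayParam, lintegral_prod_mul (measurable_one.indicator measurableSet_Iic).aemeasurable
      hw.measurable.enorm.aemeasurable, lintegral_indicator_one measurableSet_Iic,
      Measure.restrict_apply measurableSet_Iic, Iic_inter_Ioi]
    exact ENNReal.mul_ne_top measure_Ioc_lt_top.ne (hw.integrable_of_hasCompactSupport hwc).2.ne
  refine ⟨(∫⁻ z, k z ∂rayParam).toNNReal, fun F hF hFs => ?_⟩
  have hpointwise (x : Plane) : ‖(Metric.closedBall x₀ r).indicator (rayOp L w F) x‖ₑ ≤
      ∫⁻ z, k z * ‖F (x - z.1 • rayDir L z.2)‖ₑ ∂rayParam := by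
    by_cases hx : x ∈ Metric.closedBall x₀ r
    swap
    · simp [indicator_of_notMem hx]
    rw [indicator_of_mem hx]
    refine (enorm_integral_le_lintegral_enorm _).trans (lintegral_mono fun z => ?_)
    by_cases hFz : F (x - z.1 • rayDir L z.2) = 0
    · simp [hFz]
    · have hz : z.1 ∈ Iic (2 * r) :=
        le_two_mul_of_ray_mem_closedBall hx (hFs (subset_tsupport _ hFz))
      simp [k, indicator_of_mem hz]
  rw [← ENNReal.pow_le_pow_left_iff two_ne_zero, ENNReal.coe_toNNReal hk_fin, mul_pow,
    eLpNorm_two_sq, eLpNorm_two_sq]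
  exact (lintegral_mono fun x => pow_le_pow_left' (hpointwise x) 2).trans
    (lintegral_sq_average_translates_le measurable_rayPoint hk hF.measurable.enorm)

theorem sum_inner_smul_axis (v : Plane) : ∑ k, inner ℝ (axis L k) v • axis L k = v := by
  simpa [axis] using ((EuclideanSpace.basisFun (Fin 2) ℝ).map L).sum_repr' v

theorem exists_eLpNorm_fderiv_rayOp_axis_le (L : Plane ≃ₗᵢ[ℝ] Plane) (hw : IsRayWeight τ w)
    (k : Fin 2) : ∃ C : ℝ≥0, ∀ U F, IsTest U F →
      eLpNorm (fun x => fderiv ℝ (rayOp L w F) x (axis L k)) 2 volume ≤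
        C * eLpNorm F 2 volume := by
  obtain ⟨C₀, hC₀⟩ := exists_eLpNorm_fderiv_rayOp_axis_zero_le L hw.nonneg hw.contDiff
    hw.hasCompactSupport
  fin_cases k
  · exact ⟨C₀, fun U F hF => hC₀ F hF.1 hF.2⟩
  obtain ⟨C₁, hC₁⟩ := exists_eLpNorm_fderiv_rayOp_axis_zero_le L hw.id_mul.nonneg
    hw.id_mul.contDiff hw.id_mul.hasCompactSupport
  refine ⟨‖∫ t, w t‖₊ + C₁, fun U F hF => ?_⟩
  have hderiv : (fun x => fderiv ℝ (rayOp L w F) x (axis L 1)) =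
      (∫ t, w t) • F - fun x => fderiv ℝ (rayOp L (fun t => t * w t) F) x (axis L 0) := by
    ext x
    rw [Pi.sub_apply, Pi.smul_apply, smul_eq_mul, eq_sub_iff_add_eq', hw.id_mul.fderiv_rayOp hF,
      hw.fderiv_rayOp hF]
    exact rayOp_fderiv_add hw.contDiff.continuous hw.hasCompactSupport hF.1 hF.2 x
  have hmeas := (contDiff_fderiv_apply (hw.id_mul.contDiff_rayOp (L := L) hF)
    (axis L 0)).continuous.aestronglyMeasurable (μ := volume)
  calc eLpNorm (fun x => fderiv ℝ (rayOp L w F) x (axis L 1)) 2 volume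
      ≤ eLpNorm ((∫ t, w t) • F) 2 volume +
        eLpNorm (fun x => fderiv ℝ (rayOp L (fun t => t * w t) F) x (axis L 0)) 2 volume := by
        rw [hderiv]
        exact eLpNorm_sub_le (hF.1.continuous.aestronglyMeasurable.const_smul _) hmeas
          one_le_two
    _ ≤ ↑(‖∫ t, w t‖₊ + C₁) * eLpNorm F 2 volume := by
        rw [eLpNorm_const_smul, ENNReal.coe_add, add_mul]
        exact add_le_add le_rfl (hC₁ F hF.1 hF.2)

theorem exists_eLpNorm_fderiv_rayOp_le (L : Plane ≃ₗᵢ[ℝ] Plane) (hw : IsRayWeight τ w)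
    (v : Plane) : ∃ C : ℝ≥0, ∀ U F, IsTest U F →
      eLpNorm (fun x => fderiv ℝ (rayOp L w F) x v) 2 volume ≤ C * eLpNorm F 2 volume := by
  choose C hC using exists_eLpNorm_fderiv_rayOp_axis_le L hw
  refine ⟨∑ k, ‖inner ℝ (axis L k) v‖₊ * C k, fun U F hF => ?_⟩
  have hderiv (x : Plane) : fderiv ℝ (rayOp L w F) x v =
      ∑ k, inner ℝ (axis L k) v * fderiv ℝ (rayOp L w F) x (axis L k) := by
    conv_lhs => rw [← sum_inner_smul_axis (L := L) v, map_sum]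
    simp only [map_smul, smul_eq_mul]
  simp_rw [hderiv]
  refine (eLpNorm_sum_const_mul_le one_le_two _ _ fun k => (contDiff_fderiv_apply
    (hw.contDiff_rayOp hF) _).continuous.aestronglyMeasurable).trans ?_
  push_cast
  rw [Finset.sum_mul]
  refine Finset.sum_le_sum fun k _ => ?_
  rw [mul_assoc]
  exact mul_le_mul_right (hC k U F hF) _

theorem exists_eLpNorm_fderiv_mul_rayOp_le (L : Plane ≃ₗᵢ[ℝ] Plane) (hw : IsRayWeight τ w)
    {x₀ : Plane} {r : ℝ} {χ : Plane → ℝ} (hχ : IsTest (Metric.closedBall x₀ r) χ) (v : Plane) :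
    ∃ C : ℝ≥0, ∀ F, IsTest (Metric.closedBall x₀ r) F →
      eLpNorm (fun x => fderiv ℝ (fun x => χ x * rayOp L w F x) x v) 2 volume ≤
        C * eLpNorm F 2 volume := by
  obtain ⟨C₀, hC₀⟩ := exists_eLpNorm_indicator_rayOp_le L hw.contDiff.continuous
    hw.hasCompactSupport x₀ r
  obtain ⟨C₁, hC₁⟩ := exists_eLpNorm_fderiv_rayOp_le L hw v
  obtain ⟨M₀, hM₀⟩ := (hχ.fderiv_apply v).2.exists_bound_of_continuous
    (hχ.fderiv_apply v).1.continuous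
  obtain ⟨M₁, hM₁⟩ := hχ.2.exists_bound_of_continuous hχ.1.continuous
  refine ⟨M₀.toNNReal * C₀ + M₁.toNNReal * C₁, fun F hF => ?_⟩
  have hsmooth : ContDiff ℝ ∞ (rayOp L w F) := hw.contDiff_rayOp hF
  have hA : AEStronglyMeasurable ((Metric.closedBall x₀ r).indicator (rayOp L w F)) volume :=
    hsmooth.continuous.aestronglyMeasurable.indicator measurableSet_closedBall
  have hB : Continuous fun x => fderiv ℝ (rayOp L w F) x v :=
    (contDiff_fderiv_apply hsmooth v).continuous
  simp_rw [hχ.fderiv_mul_apply (hsmooth.differentiable (by simp))]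
  refine (eLpNorm_add_le ((hχ.fderiv_apply v).1.continuous.aestronglyMeasurable.mul hA)
    (hχ.1.continuous.mul hB).aestronglyMeasurable one_le_two).trans ?_
  push_cast
  simp_rw [add_mul, mul_assoc]
  exact add_le_add
    ((eLpNorm_mul_le_of_norm_le hM₀ _ _).trans (mul_le_mul_right (hC₀ F hF.1.continuous hF.3) _))
    ((eLpNorm_mul_le_of_norm_le hM₁ _ _).trans (mul_le_mul_right (hC₁ _ F hF) _))

/-- Inside `closedBall x₀ r`, the set `Ω` is stable under translations along the cone of directions
`rayDir L t` with `0 ≤ t ≤ τ`. -/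
def HasCone (Ω : Set Plane) (x₀ : Plane) (r τ : ℝ) (L : Plane ≃ₗᵢ[ℝ] Plane) : Prop :=
  ∀ y ∈ Ω ∩ Metric.closedBall x₀ r, ∀ s t : ℝ, 0 ≤ s → t ∈ Icc 0 τ →
    y + s • rayDir L t ∈ Metric.closedBall x₀ r → y + s • rayDir L t ∈ Ω

theorem IsTest.mul_rayOp {Ω : Set Plane} {x₀ : Plane} {r : ℝ} (hcone : HasCone Ω x₀ r τ L)
    (hw : IsRayWeight τ w) {χ F : Plane → ℝ} (hχ : IsTest (Metric.closedBall x₀ r) χ)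
    (hF : IsTest (Ω ∩ Metric.closedBall x₀ r) F) : IsTest Ω fun x => χ x * rayOp L w F x := by
  refine ⟨hχ.1.mul (hw.contDiff_rayOp hF), hχ.2.mul_right, ?_⟩
  set S := (fun q : Plane × (ℝ × ℝ) => q.1 + q.2.1 • rayDir L q.2.2) ''
    (tsupport F ×ˢ (Icc 0 (2 * r) ×ˢ Icc 0 τ))
  have hS : IsCompact S := by
    refine (hF.2.isCompact.prod (isCompact_Icc.prod isCompact_Icc)).image ?_
    have := continuous_rayDir L
    fun_prop
  have hsupport : tsupport (fun x => χ x * rayOp L w F x) ⊆ S ∩ Metric.closedBall x₀ r := by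
    refine closure_minimal (fun x hx => ?_) (hS.isClosed.inter Metric.isClosed_closedBall)
    have hxB : x ∈ Metric.closedBall x₀ r := hχ.3 (subset_tsupport _ (left_ne_zero_of_mul hx))
    obtain ⟨s, t, hs, ht, hFy⟩ := exists_of_rayOp_ne_zero (right_ne_zero_of_mul hx)
    have hy := subset_tsupport F hFy
    exact ⟨⟨(x - s • rayDir L t, (s, t)), ⟨hy, ⟨hs.le,
      le_two_mul_of_ray_mem_closedBall hxB (hF.3 hy).2⟩, hw.mem_Icc t ht⟩, by simp⟩, hxB⟩
  refine hsupport.trans ?_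
  rintro _ ⟨⟨⟨y, s, t⟩, ⟨hy, hs, ht⟩, rfl⟩, hB⟩
  exact hcone y (hF.3 hy) s t hs.1 ht hB

theorem IsBoundedLipschitzDomain.exists_hasCone {Ω : Set Plane} (hΩ : IsBoundedLipschitzDomain Ω)
    {x₀ : Plane} (hx₀ : x₀ ∈ closure Ω) : ∃ r τ L, 0 < r ∧ 0 < τ ∧ HasCone Ω x₀ r τ L := by
  by_cases hx : x₀ ∈ Ω
  · obtain ⟨r, hr, hrΩ⟩ := Metric.nhds_basis_closedBall.mem_iff.1 (hΩ.isOpen.mem_nhds hx)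
    exact ⟨r, 1, LinearIsometryEquiv.refl ℝ Plane, hr, one_pos, fun y _ s t _ _ h => hrΩ h⟩
  · have hfr : x₀ ∈ frontier Ω := hΩ.isOpen.frontier_eq ▸ ⟨hx₀, hx⟩
    obtain ⟨e, γ, K, hγ, U, hU, hUΩ⟩ := hΩ.lipschitz_boundary x₀ hfr
    obtain ⟨r, hr, hrU⟩ := Metric.nhds_basis_closedBall.mem_iff.1 hU
    refine ⟨r, 1 / (K + 1), e.linearIsometryEquiv.symm, hr, by positivity, ?_⟩
    rintro y ⟨hyΩ, hyB⟩ s t hs ⟨ht0, htK⟩ hz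
    have hy : γ (e y 0) < e y 1 := (hUΩ y (hrU hyB)).1 hyΩ
    have he : e (y + s • rayDir e.linearIsometryEquiv.symm t) =
        e y + s • (t • EuclideanSpace.single 0 1 + EuclideanSpace.single 1 1) := by
      rw [add_comm y, ← vadd_eq_add, e.map_vadd, vadd_eq_add, add_comm (e y)]
      simp [rayDir, axis]
    have he0 : e (y + s • rayDir e.linearIsometryEquiv.symm t) 0 = e y 0 + s * t := by
      rw [he]; simp
    have he1 : e (y + s • rayDir e.linearIsometryEquiv.symm t) 1 = e y 1 + s := by
      rw [he]; simp
    have hγ_le : γ (e y 0 + s * t) - γ (e y 0) ≤ K * (s * t) := by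
      have := hγ.dist_le_mul (e y 0 + s * t) (e y 0)
      rw [Real.dist_eq, Real.dist_eq, add_sub_cancel_left,
        abs_of_nonneg (mul_nonneg hs ht0)] at this
      exact (le_abs_self _).trans this
    have hslope : (K : ℝ) * (s * t) ≤ s := by
      have : (K : ℝ) * t ≤ 1 := by
        rw [le_div_iff₀ (by positivity)] at htK
        linarith
      nlinarith
    rw [hUΩ _ (hrU hz), he0, he1]
    linarith

/-- The components of the weighted direction `w t • (t, 1)`. -/
def slopeWeight (w : ℝ → ℝ) : Fin 2 → ℝ → ℝ := ![fun t => t * w t, w]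

theorem IsRayWeight.slopeWeight (hw : IsRayWeight τ w) (k : Fin 2) :
    IsRayWeight τ (slopeWeight w k) := by
  fin_cases k
  exacts [hw.id_mul, hw]

theorem IsRayWeight.sum_fderiv_mul_rayOp (hw : IsRayWeight τ w) {U V : Set Plane}
    {χ F : Plane → ℝ} (hχ : IsTest U χ) (hF : IsTest V F) (x : Plane) :
    ∑ k, fderiv ℝ (fun x => χ x * rayOp L (StokesLPS.slopeWeight w k) F x) x (axis L k) =
      (∫ t, w t) * (χ x * F x) +
        ∑ k, fderiv ℝ χ x (axis L k) * rayOp L (StokesLPS.slopeWeight w k) F x := by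
  have hleibniz (k : Fin 2) :
      fderiv ℝ (fun x => χ x * rayOp L (StokesLPS.slopeWeight w k) F x) x (axis L k) =
        χ x * rayOp L (StokesLPS.slopeWeight w k) (fun y => fderiv ℝ F y (axis L k)) x +
          fderiv ℝ χ x (axis L k) * rayOp L (StokesLPS.slopeWeight w k) F x := by
    rw [fderiv_fun_mul (hχ.1.differentiable (by simp) x)
      (((hw.slopeWeight k).contDiff_rayOp hF).differentiable (by simp) x),
      ← (hw.slopeWeight k).fderiv_rayOp hF]
    simp only [add_apply, smul_apply, smul_eq_mul]
    ring
  have hrec : ∑ k, rayOp L (StokesLPS.slopeWeight w k) (fun y => fderiv ℝ F y (axis L k)) x =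
      (∫ t, w t) * F x := by
    rw [Fin.sum_univ_two]
    exact rayOp_fderiv_add hw.contDiff.continuous hw.hasCompactSupport hF.1 hF.2 x
  simp_rw [hleibniz, Finset.sum_add_distrib, ← Finset.mul_sum, hrec]
  ring

theorem norm_axis_apply_le (k i : Fin 2) : ‖axis L k i‖ ≤ 1 :=
  (PiLp.norm_apply_le (axis L k) i).trans_eq (norm_axis L k)

theorem eLpNorm_partialDeriv_sum_const_mul_le {U : Set Plane} {f : Fin 2 → Plane → ℝ}
    (hf : ∀ k, IsTest U (f k)) {c : Fin 2 → ℝ} (hc : ∀ k, ‖c k‖ ≤ 1) (j : Fin 2)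
    {D : Fin 2 → ℝ≥0} {N : ENNReal}
    (h : ∀ k, eLpNorm (partialDeriv j (f k)) 2 volume ≤ D k * N) :
    eLpNorm (partialDeriv j fun x => ∑ k, c k * f k x) 2 volume ≤ ↑(∑ k, D k) * N :=
  calc eLpNorm (partialDeriv j fun x => ∑ k, c k * f k x) 2 volume
      = eLpNorm (fun x => ∑ k, c k * partialDeriv j (f k) x) 2 volume := by
        congr 1; ext x; exact IsTest.fderiv_sum_const_mul hf c x _
    _ ≤ ∑ k, ‖c k‖ₑ * eLpNorm (partialDeriv j (f k)) 2 volume :=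
        eLpNorm_sum_const_mul_le one_le_two _ _ fun k =>
          ((hf k).partialDeriv j).1.continuous.aestronglyMeasurable
    _ ≤ ∑ k, 1 * (D k * N) :=
        Finset.sum_le_sum fun k _ =>
          mul_le_mul' (enorm_le_coe.2 (NNReal.coe_le_coe.1 (hc k))) (h k)
    _ = ↑(∑ k, D k) * N := by
        simp only [one_mul, ENNReal.ofNNReal_finsetSum, Finset.sum_mul]

theorem divergence_sum_axis_mul {U : Set Plane} {g : Fin 2 → Plane → ℝ}
    (hg : ∀ k, IsTest U (g k)) (x : Plane) :
    ∑ i, partialDeriv i (fun x => ∑ k, axis L k i * g k x) x =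
      ∑ k, fderiv ℝ (g k) x (axis L k) := by
  simp_rw [fderiv_apply_eq_sum_partialDeriv (g _)]
  rw [Finset.sum_comm]
  exact Finset.sum_congr rfl fun i _ => IsTest.fderiv_sum_const_mul hg (axis L · i) x _

theorem HasCone.exists_local_solver {Ω : Set Plane} {x₀ : Plane} {r : ℝ} (hr : 0 < r)
    (hτ : 0 < τ) (hcone : HasCone Ω x₀ r τ L) : ∃ C : ℝ≥0,
      ∀ F, IsTest (Ω ∩ Metric.ball x₀ (r / 2)) F → ∃ (v : Fin 2 → Plane → ℝ) (R : Plane → ℝ),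
        (∀ i, IsTest Ω (v i)) ∧ IsTest Ω R ∧
        (∀ x, ∑ i, partialDeriv i (v i) x = F x + R x) ∧
        (∀ i j, eLpNorm (partialDeriv j (v i)) 2 volume ≤ C * eLpNorm F 2 volume) ∧
        ∀ j, eLpNorm (partialDeriv j R) 2 volume ≤ C * eLpNorm F 2 volume := by
  obtain ⟨w, hw, hw1⟩ := exists_isRayWeight hτ
  let b : ContDiffBump x₀ := ⟨r / 2, r, by positivity, by linarith⟩
  have hb : IsTest (Metric.closedBall x₀ r) b :=
    ⟨b.contDiff, b.hasCompactSupport, b.tsupport_eq.subset⟩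
  choose A hA using fun k j : Fin 2 => exists_eLpNorm_fderiv_mul_rayOp_le L (hw.slopeWeight k) hb
    (EuclideanSpace.single j 1)
  choose B hB using fun k j : Fin 2 => exists_eLpNorm_fderiv_mul_rayOp_le L (hw.slopeWeight k)
    (hb.fderiv_apply (axis L k)) (EuclideanSpace.single j 1)
  refine ⟨∑ j, ∑ k, (A k j + B k j), fun F hF => ?_⟩
  have hF' : IsTest (Ω ∩ Metric.closedBall x₀ r) F :=
    hF.mono (inter_subset_inter_right _ (Metric.ball_subset_closedBall.trans
      (Metric.closedBall_subset_closedBall (by linarith))))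
  set g : Fin 2 → Plane → ℝ := fun k x => b x * rayOp L (slopeWeight w k) F x
  set q : Fin 2 → Plane → ℝ := fun k x => fderiv ℝ b x (axis L k) * rayOp L (slopeWeight w k) F x
  have hg (k : Fin 2) : IsTest Ω (g k) := hb.mul_rayOp hcone (hw.slopeWeight k) hF'
  have hq (k : Fin 2) : IsTest Ω (q k) :=
    (hb.fderiv_apply (axis L k)).mul_rayOp hcone (hw.slopeWeight k) hF'
  have hC (j : Fin 2) {D : Fin 2 → ℝ≥0} (hD : ∀ k, D k ≤ A k j + B k j) :
      ∑ k, D k ≤ ∑ j, ∑ k, (A k j + B k j) :=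
    (Finset.sum_le_sum fun k _ => hD k).trans (Finset.single_le_sum
      (f := fun j => ∑ k, (A k j + B k j)) (fun _ _ => zero_le) (Finset.mem_univ j))
  refine ⟨fun i x => ∑ k, axis L k i * g k x, fun x => ∑ k, 1 * q k x,
    fun i => .sum _ fun k => (hg k).const_mul _, .sum _ fun k => (hq k).const_mul _, fun x => ?_,
    fun i j => (eLpNorm_partialDeriv_sum_const_mul_le hg (norm_axis_apply_le · i) j
      fun k => hA k j F (hF'.mono inter_subset_right)).trans
        (mul_le_mul_left (ENNReal.coe_le_coe.2 (hC j fun _ => le_self_add)) _),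
    fun j => (eLpNorm_partialDeriv_sum_const_mul_le hq (by simp) j
      fun k => hB k j F (hF'.mono inter_subset_right)).trans
        (mul_le_mul_left (ENNReal.coe_le_coe.2 (hC j fun _ => le_add_self)) _)⟩
  have hbF : b x * F x = F x := by
    by_cases hx : F x = 0
    · simp [hx]
    · rw [b.one_of_mem_closedBall (Metric.ball_subset_closedBall
        (hF.3 (subset_tsupport _ hx)).2), one_mul]
  calc ∑ i, partialDeriv i (fun x => ∑ k, axis L k i * g k x) x
      = ∑ k, fderiv ℝ (g k) x (axis L k) := divergence_sum_axis_mul hg x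
    _ = F x + ∑ k, 1 * q k x := by
        simp_rw [g, hw.sum_fderiv_mul_rayOp hb hF, hw1, hbF, one_mul, q]

end LocalSolver

/-! ### Test functions in `L²(Ω)` -/

section Test

variable {U Ω : Set Plane} {f : Plane → ℝ}

/-- The `L²` norm of a function on the plane; it is used for square integrable functions only. -/
def l2norm (f : Plane → ℝ) : ℝ := (eLpNorm f 2 volume).toReal

theorem l2norm_nonneg (f : Plane → ℝ) : 0 ≤ l2norm f := ENNReal.toReal_nonneg

theorem IsTest.memLp (hf : IsTest U f) (μ : Measure Plane) [IsFiniteMeasureOnCompacts μ] :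
    MemLp f 2 μ := hf.contDiff.continuous.memLp_of_hasCompactSupport hf.hasCompactSupport

theorem IsTest.eLpNorm_ne_top (hf : IsTest U f) : eLpNorm f 2 volume ≠ ⊤ :=
  (hf.memLp volume).eLpNorm_ne_top

theorem IsTest.l2norm_le_of_eLpNorm_le {g : Plane → ℝ} {C : ℝ≥0} (hf : IsTest U f)
    (h : eLpNorm g 2 volume ≤ C * eLpNorm f 2 volume) : l2norm g ≤ C * l2norm f := by
  have := ENNReal.toReal_mono (ENNReal.mul_ne_top ENNReal.coe_ne_top hf.eLpNorm_ne_top) h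
  rwa [ENNReal.toReal_mul] at this

variable (Ω) in
/-- A test function as an element of `L²(Ω)`. -/
def IsTest.toL2 (hf : IsTest U f) : L2 Ω := (hf.memLp (volume.restrict Ω)).toLp f

theorem IsTest.coeFn_toL2 (hf : IsTest U f) : hf.toL2 Ω =ᵐ[volume.restrict Ω] f :=
  MemLp.coeFn_toLp _

theorem IsTest.norm_toL2 (hf : IsTest Ω f) : ‖hf.toL2 Ω‖ = l2norm f := by
  rw [IsTest.toL2, Lp.norm_toLp, eLpNorm_restrict_eq_of_support_subset
    ((subset_tsupport f).trans hf.tsupport_subset), l2norm]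

theorem IsTest.inner_toL2 (hf : IsTest U f) (p : L2 Ω) :
    inner ℝ (hf.toL2 Ω) p = ∫ x in Ω, p x * f x := by
  rw [inner_L2_eq_integral]
  refine integral_congr_ae ?_
  filter_upwards [hf.coeFn_toL2 (Ω := Ω)] with x hx
  rw [hx, mul_comm]

theorem mem_testJets_iff {J : L2 Ω × (Fin 2 → L2 Ω)} :
    J ∈ testJets Ω ↔
      ∃ f, ∃ hf : IsTest Ω f, J = (hf.toL2 Ω, fun j => (hf.partialDeriv j).toL2 Ω) := by
  constructor
  · rintro ⟨f, h₁, h₂, h₃, h, h'⟩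
    have hf : IsTest Ω f := ⟨h₁, h₂, h₃⟩
    exact ⟨f, hf, Prod.ext (Lp.ext (h.trans hf.coeFn_toL2.symm))
      (funext fun j => Lp.ext ((h' j).trans (hf.partialDeriv j).coeFn_toL2.symm))⟩
  · rintro ⟨f, hf, rfl⟩
    exact ⟨f, hf.contDiff, hf.hasCompactSupport, hf.tsupport_subset, hf.coeFn_toL2,
      fun j => (hf.partialDeriv j).coeFn_toL2⟩

/-- A velocity field with smooth components of compact support. -/
def testVelocity {v : Fin 2 → Plane → ℝ} (hv : ∀ i, IsTest Ω (v i)) : Velocity Ω :=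
  fun i => ⟨((hv i).toL2 Ω, fun j => ((hv i).partialDeriv j).toL2 Ω),
    (testJets Ω).le_topologicalClosure (mem_testJets_iff.2 ⟨v i, hv i, rfl⟩)⟩

theorem bForm_testVelocity {v : Fin 2 → Plane → ℝ} (hv : ∀ i, IsTest Ω (v i)) (p : L2 Ω) :
    bForm (testVelocity hv) p = ∫ x in Ω, p x * ∑ i, partialDeriv i (v i) x := by
  have h : bForm (testVelocity hv) p = ∑ i, inner ℝ (((hv i).partialDeriv i).toL2 Ω) p := by
    rw [bForm_eq_bBilin, bBilin_apply]
    rfl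
  simp_rw [h, IsTest.inner_toL2, Finset.mul_sum]
  rw [integral_finsetSum]
  exact fun i _ => (Lp.memLp p).integrable_mul (((hv i).partialDeriv i).memLp _)

theorem dense_map_fst_testJets (hU : IsOpen U) :
    Dense ((testJets U).map (LinearMap.fst ℝ (L2 U) (Fin 2 → L2 U)) : Set (L2 U)) := by
  rw [Submodule.dense_iff_topologicalClosure_eq_top, Submodule.topologicalClosure_eq_top_iff,
    Submodule.eq_bot_iff]
  intro q hq
  have hint : LocallyIntegrableOn q U volume :=
    locallyIntegrableOn_of_locallyIntegrable_restrict
      ((Lp.memLp q).locallyIntegrable (by norm_num))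
  refine Lp.eq_zero_iff_ae_eq_zero.2 ((ae_restrict_iff' hU.measurableSet).2 ?_)
  refine hU.ae_eq_zero_of_integral_contDiff_smul_eq_zero hint fun f h₁ h₂ h₃ => ?_
  have hf : IsTest U f := ⟨h₁, h₂, h₃⟩
  have horth : inner ℝ (hf.toL2 U) q = 0 :=
    hq _ ⟨_, mem_testJets_iff.2 ⟨f, hf, rfl⟩, rfl⟩
  rw [hf.inner_toL2] at horth
  rw [← horth]
  simp only [smul_eq_mul, mul_comm (f _)]
  refine (setIntegral_eq_integral_of_forall_compl_eq_zero fun x hx => ?_).symm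
  rw [image_eq_zero_of_notMem_tsupport fun h => hx (h₃ h), mul_zero]

theorem norm_le_of_inner_le_of_dense {E : Type*} [NormedAddCommGroup E] [InnerProductSpace ℝ E]
    {S : Set E} (hS : Dense S) {p : E} {A : ℝ} (hA : 0 ≤ A)
    (h : ∀ q ∈ S, inner ℝ q p ≤ A * ‖q‖) : ‖p‖ ≤ A := by
  have hp : inner ℝ p p ≤ A * ‖p‖ :=
    closure_minimal (t := {q : E | inner ℝ q p ≤ A * ‖q‖}) h
      (isClosed_le (by fun_prop) (by fun_prop)) (hS p)
  rw [real_inner_self_eq_norm_sq] at hp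
  rcases (norm_nonneg p).eq_or_lt with h0 | h0
  · exact h0 ▸ hA
  · nlinarith

theorem toReal_eLpNorm_le_of_integral_test_le (hU : IsOpen U) {p : Plane → ℝ}
    (hp : MemLp p 2 (volume.restrict U)) {A : ℝ} (hA : 0 ≤ A)
    (h : ∀ f, IsTest U f → ∫ x in U, p x * f x ≤ A * l2norm f) :
    (eLpNorm p 2 (volume.restrict U)).toReal ≤ A := by
  rw [← Lp.norm_toLp _ hp]
  refine norm_le_of_inner_le_of_dense (dense_map_fst_testJets hU) hA ?_
  rintro _ ⟨J, hJ, rfl⟩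
  obtain ⟨f, hf, rfl⟩ := mem_testJets_iff.1 hJ
  have hcongr : ∫ x in U, hp.toLp p x * f x = ∫ x in U, p x * f x := by
    refine integral_congr_ae ?_
    filter_upwards [hp.coeFn_toLp] with x hx
    rw [hx]
  rw [LinearMap.fst_apply, hf.inner_toL2, hf.norm_toL2, hcongr]
  exact h f hf

end Test

section Poincare

variable {Ω : Set Plane}

theorem norm_fderiv_le_sum_norm_partialDeriv (f : Plane → ℝ) (x : Plane) :
    ‖fderiv ℝ f x‖ ≤ ∑ j, ‖partialDeriv j f x‖ := by
  refine ContinuousLinearMap.opNorm_le_bound _ (by positivity) fun v => ?_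
  rw [fderiv_apply_eq_sum_partialDeriv, Finset.sum_mul]
  refine (norm_sum_le _ _).trans (Finset.sum_le_sum fun j _ => ?_)
  rw [norm_mul, mul_comm]
  gcongr
  exact PiLp.norm_apply_le v j

theorem eLpNorm_fderiv_le_sum_partialDeriv {f : Plane → ℝ} (hf : ContDiff ℝ 1 f) :
    eLpNorm (fderiv ℝ f) 2 volume ≤ ∑ j, eLpNorm (partialDeriv j f) 2 volume := by
  have hc (j : Fin 2) : Continuous (partialDeriv j f) :=
    (hf.continuous_fderiv one_ne_zero).clm_apply continuous_const
  calc eLpNorm (fderiv ℝ f) 2 volume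
      ≤ eLpNorm (∑ j, fun x => ‖partialDeriv j f x‖) 2 volume :=
        eLpNorm_mono_real fun x => by
          simpa only [Finset.sum_apply] using norm_fderiv_le_sum_norm_partialDeriv f x
    _ ≤ ∑ j, eLpNorm (fun x => ‖partialDeriv j f x‖) 2 volume :=
        eLpNorm_sum_le (fun j _ => (hc j).norm.aestronglyMeasurable) (by norm_num)
    _ = _ := Finset.sum_congr rfl fun j _ => eLpNorm_norm _

/-- The Sobolev inequality bounds `‖f‖₂` by the `L¹` norm of the gradient, and Hölder's inequality
on the bounded set `Ω` that one by the `L²` norm. -/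
theorem exists_l2norm_le_sum_partialDeriv (hΩ : Bornology.IsBounded Ω) :
    ∃ C : ℝ≥0, ∀ f, IsTest Ω f → l2norm f ≤ C * ∑ j, l2norm (partialDeriv j f) := by
  set K := eLpNormLESNormFDerivOneConst (volume : Measure Plane) 2
  set V := volume Ω ^ (1 / 2 : ℝ)
  have hV : V ≠ ⊤ := ENNReal.rpow_ne_top_of_nonneg (by norm_num) hΩ.measure_lt_top.ne
  refine ⟨K * V.toNNReal, fun f hf => ?_⟩
  have hf₁ : ContDiff ℝ 1 f := hf.contDiff.of_le (by simp)
  have hsobolev : eLpNorm f 2 volume ≤ K * eLpNorm (fderiv ℝ f) 1 volume := by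
    have h2 : NNReal.HolderConjugate (Module.finrank ℝ Plane) 2 := by
      simpa using NNReal.HolderConjugate.two_two
    simpa using eLpNorm_le_eLpNorm_fderiv_one volume hf₁ hf.hasCompactSupport h2
  have hholder : eLpNorm (fderiv ℝ f) 1 volume ≤ eLpNorm (fderiv ℝ f) 2 volume * V := by
    have hs : Function.support (fun x => ‖fderiv ℝ f x‖) ⊆ Ω := fun x hx =>
      hf.tsupport_subset (support_fderiv_subset ℝ (norm_ne_zero_iff.1 hx))
    have h := eLpNorm_le_eLpNorm_mul_rpow_measure_univ (p := 1) (q := 2) (μ := volume.restrict Ω)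
      (by norm_num) (hf₁.continuous_fderiv one_ne_zero).norm.aestronglyMeasurable
    have he : 1 / (1 : ENNReal).toReal - 1 / (2 : ENNReal).toReal = (1 / 2 : ℝ) := by norm_num
    rwa [eLpNorm_restrict_eq_of_support_subset hs, eLpNorm_restrict_eq_of_support_subset hs,
      eLpNorm_norm, eLpNorm_norm, Measure.restrict_apply_univ, he] at h
  have hsum : eLpNorm f 2 volume ≤
      K * V.toNNReal * ∑ j, eLpNorm (partialDeriv j f) 2 volume := by
    rw [ENNReal.coe_toNNReal hV, mul_assoc, mul_comm V]
    refine hsobolev.trans ?_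
    gcongr
    exact hholder.trans (by gcongr; exact eLpNorm_fderiv_le_sum_partialDeriv hf₁)
  have hfin (j : Fin 2) : eLpNorm (partialDeriv j f) 2 volume ≠ ⊤ :=
    (hf.partialDeriv j).eLpNorm_ne_top
  have := ENNReal.toReal_mono (ENNReal.mul_ne_top (by finiteness)
    (ENNReal.sum_ne_top.2 fun j _ => hfin j)) hsum
  rw [ENNReal.toReal_mul, ENNReal.toReal_sum fun j _ => hfin j] at this
  simpa [l2norm] using this

theorem exists_norm_le_sum_norm_of_mem_H10 (hΩ : Bornology.IsBounded Ω) :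
    ∃ C : ℝ≥0, ∀ J ∈ H10 Ω, ‖J.1‖ ≤ C * ∑ j, ‖J.2 j‖ := by
  obtain ⟨C, hC⟩ := exists_l2norm_le_sum_partialDeriv hΩ
  have hclosed : IsClosed {J : L2 Ω × (Fin 2 → L2 Ω) | ‖J.1‖ ≤ C * ∑ j, ‖J.2 j‖} :=
    isClosed_le (by fun_prop) (by fun_prop)
  refine ⟨C, fun J hJ => ?_⟩
  refine closure_minimal (s := (testJets Ω : Set (L2 Ω × (Fin 2 → L2 Ω)))) (fun J hJ => ?_)
    hclosed hJ
  obtain ⟨f, hf, rfl⟩ := mem_testJets_iff.1 hJ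
  simpa only [mem_ofPred_eq, IsTest.norm_toL2] using hC f hf

theorem exists_poincareInequality (hΩ : Bornology.IsBounded Ω) :
    ∃ P : ℝ, 0 < P ∧ PoincareInequality Ω P := by
  obtain ⟨C, hC⟩ := exists_norm_le_sum_norm_of_mem_H10 hΩ
  refine ⟨2 * (C : ℝ) ^ 2 + 1, by positivity, fun v => ?_⟩
  rw [norm1_sq, add_mul, one_mul]
  gcongr
  rw [rForm_self_eq, aForm_self_eq, Finset.mul_sum]
  gcongr with i
  calc ‖v.comp i‖ ^ 2 ≤ (C * ∑ j, ‖v.grad i j‖) ^ 2 := by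
        gcongr
        exact hC _ (v i).2
    _ = (C : ℝ) ^ 2 * (∑ j, ‖v.grad i j‖) ^ 2 := mul_pow _ _ _
    _ ≤ (C : ℝ) ^ 2 * (2 * ∑ j, ‖v.grad i j‖ ^ 2) := by
        gcongr
        simpa using sq_sum_le_card_mul_sum_sq (s := Finset.univ) (f := fun j => ‖v.grad i j‖)
    _ = _ := by ring

end Poincare

/-! ### Rellich's theorem -/

theorem lintegral_enorm_translate_sub_sq_le {E : Type*} [NormedAddCommGroup E] [NormedSpace ℝ E]
    [MeasurableSpace E] [BorelSpace E] [SecondCountableTopology E] {μ : Measure E} [SFinite μ]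
    [μ.IsAddRightInvariant] {f : E → ℝ} (hf : ContDiff ℝ 1 f) (s : E) :
    ∫⁻ x, ‖f (x + s) - f x‖ₑ ^ 2 ∂μ ≤ ∫⁻ x, ‖fderiv ℝ f x s‖ₑ ^ 2 ∂μ := by
  have hderiv : Continuous fun x => fderiv ℝ f x s :=
    (hf.continuous_fderiv one_ne_zero).clm_apply continuous_const
  have hftc (x : E) : f (x + s) - f x = ∫ t in (0 : ℝ)..1, fderiv ℝ f (x + t • s) s := by
    have h (t : ℝ) : HasDerivAt (fun t : ℝ => f (x + t • s)) (fderiv ℝ f (x + t • s) s) t :=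
      ((hf.differentiable one_ne_zero _).hasFDerivAt).comp_hasDerivAt t
        (by simpa using ((hasDerivAt_id t).smul_const s).const_add x)
    rw [intervalIntegral.integral_eq_sub_of_hasDerivAt (fun t _ => h t)
      ((hderiv.comp (by fun_prop)).intervalIntegrable _ _)]
    simp
  calc ∫⁻ x, ‖f (x + s) - f x‖ₑ ^ 2 ∂μ
      ≤ ∫⁻ x, (∫⁻ t in Ioc (0 : ℝ) 1, 1 * ‖fderiv ℝ f (x - -(t • s)) s‖ₑ) ^ 2 ∂μ := by
        gcongr with x
        simp only [hftc, intervalIntegral.integral_of_le zero_le_one, one_mul, sub_neg_eq_add]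
        exact enorm_integral_le_lintegral_enorm _
    _ ≤ (∫⁻ _ in Ioc (0 : ℝ) 1, 1) ^ 2 * ∫⁻ x, ‖fderiv ℝ f x s‖ₑ ^ 2 ∂μ :=
        lintegral_sq_average_translates_le (T := fun t : ℝ => -(t • s)) (by fun_prop)
          measurable_const hderiv.measurable.enorm
    _ = _ := by simp

theorem enorm_sub_average_sq_le {α : Type*} [MeasurableSpace α] {μ : Measure α}
    [IsFiniteMeasure μ] [NeZero μ] {f : α → ℝ} (hf : Integrable f μ) (a : ℝ) :
    ‖a - ⨍ x, f x ∂μ‖ₑ ^ 2 ≤ ⨍⁻ x, ‖a - f x‖ₑ ^ 2 ∂μ := by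
  have hdiff : Integrable (fun x => a - f x) ((μ univ)⁻¹ • μ) :=
    (integrable_const a).sub hf.to_average
  have havg : a - ⨍ x, f x ∂μ = ∫ x, (a - f x) ∂((μ univ)⁻¹ • μ) := by
    rw [integral_sub (integrable_const a) hf.to_average, integral_const, probReal_univ, one_smul]
    rfl
  calc ‖a - ⨍ x, f x ∂μ‖ₑ ^ 2 ≤ (∫⁻ x, 1 * ‖a - f x‖ₑ ∂((μ univ)⁻¹ • μ)) ^ 2 := by
        simp only [havg, one_mul]
        gcongr
        exact enorm_integral_le_lintegral_enorm _
    _ ≤ (∫⁻ _, 1 ∂((μ univ)⁻¹ • μ)) * ∫⁻ x, 1 * ‖a - f x‖ₑ ^ 2 ∂((μ univ)⁻¹ • μ) :=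
        sq_lintegral_mul_le aemeasurable_const hdiff.1.enorm
    _ = _ := by simp [laverage]

theorem coeFn_sum_smul_indicatorConstLp_fiber {α ι : Type*} [MeasurableSpace α] {μ : Measure α}
    [IsFiniteMeasure μ] {k : α → ι} (hk : ∀ m, MeasurableSet (k ⁻¹' {m})) {T : Finset ι}
    (hT : ∀ᵐ x ∂μ, k x ∈ T) (c : ι → ℝ) :
    ⇑(∑ m ∈ T, c m • indicatorConstLp 2 (hk m) (measure_ne_top μ _) (1 : ℝ)) =ᵐ[μ]
      fun x => c (k x) := by
  have hterm : ∀ᵐ x ∂μ, ∀ m ∈ T,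
      (c m • indicatorConstLp 2 (hk m) (measure_ne_top μ _) (1 : ℝ) : Lp ℝ 2 μ) x =
        c m * (k ⁻¹' {m}).indicator 1 x := by
    refine (Finset.eventually_all T).2 fun m _ => ?_
    filter_upwards [Lp.coeFn_smul (c m) (indicatorConstLp 2 (hk m) (measure_ne_top μ _) (1 : ℝ)),
      indicatorConstLp_coeFn (p := 2) (hs := hk m) (hμs := measure_ne_top μ _) (c := (1 : ℝ))]
      with x hsmul hind
    rw [hsmul, Pi.smul_apply, hind, smul_eq_mul]
    rfl
  filter_upwards [hT, hterm, Lp.coeFn_finsetSum T fun m =>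
    c m • indicatorConstLp 2 (hk m) (measure_ne_top μ _) (1 : ℝ)] with x hx hterm hsum
  rw [hsum, Finset.sum_apply, Finset.sum_congr rfl hterm, Finset.sum_eq_single_of_mem (k x) hx]
  · simp
  · intro m _ hm
    simp [hm.symm]

section Grid

variable {h : ℝ}

/-- The index of the cell that contains `x` in the grid of half-open squares of side `h`. -/
def gridIndex (h : ℝ) (x : Plane) : Fin 2 → ℤ := fun i => ⌊x i / h⌋

/-- The cell with index `m` of the grid of half-open squares of side `h`. -/
def gridCell (h : ℝ) (m : Fin 2 → ℤ) : Set Plane := gridIndex h ⁻¹' {m}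

theorem measurable_gridIndex (h : ℝ) : Measurable (gridIndex h) :=
  measurable_pi_lambda _ fun i => Int.measurable_floor.comp (by fun_prop)

theorem measurableSet_gridCell (h : ℝ) (m : Fin 2 → ℤ) : MeasurableSet (gridCell h m) :=
  measurable_gridIndex h (measurableSet_singleton m)

theorem volume_setOf_forall_mem (S : Fin 2 → Set ℝ) (hS : ∀ i, MeasurableSet (S i)) :
    volume {x : Plane | ∀ i, x i ∈ S i} = ∏ i, volume (S i) := by
  rw [← volume_pi_pi, ← (PiLp.volume_preserving_ofLp (Fin 2)).measure_preimage
    (MeasurableSet.univ_pi hS).nullMeasurableSet]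
  congr 1
  ext x
  simp

theorem volume_gridCell (hh : 0 < h) (m : Fin 2 → ℤ) :
    volume (gridCell h m) = ENNReal.ofReal h ^ 2 := by
  have hcell : gridCell h m = {x : Plane | ∀ i, x i ∈ Ico (m i * h) ((m i + 1) * h)} := by
    ext x
    simp only [gridCell, gridIndex, mem_preimage, mem_singleton_iff, funext_iff, Int.floor_eq_iff,
      le_div_iff₀ hh, div_lt_iff₀ hh, mem_ofPred_eq, mem_Ico]
  have hside (i : Fin 2) : (m i + 1) * h - m i * h = h := by ring
  rw [hcell, volume_setOf_forall_mem _ fun _ => measurableSet_Ico]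
  simp [hside]

/-- The square of all differences of two points of the same grid cell. -/
def gridBox (h : ℝ) : Set Plane := {s | ∀ i, s i ∈ Ioo (-h) h}

theorem measurableSet_gridBox (h : ℝ) : MeasurableSet (gridBox h) := by
  rw [gridBox, ofPred_forall]
  exact MeasurableSet.iInter fun i => measurableSet_Ioo.preimage (by fun_prop)

theorem volume_gridBox (h : ℝ) : volume (gridBox h) = ENNReal.ofReal (2 * h) ^ 2 := by
  rw [gridBox, volume_setOf_forall_mem _ fun _ => measurableSet_Ioo]
  simp [two_mul]

theorem mem_gridBox_of_gridIndex_add_eq (hh : 0 < h) {x s : Plane}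
    (hs : gridIndex h (x + s) = gridIndex h x) : s ∈ gridBox h := fun i => by
  have hi := Int.abs_sub_lt_one_of_floor_eq_floor (congrFun hs i)
  rwa [← sub_div, PiLp.add_apply, add_sub_cancel_left, abs_div, abs_of_pos hh, div_lt_one hh,
    abs_lt] at hi

theorem setLIntegral_gridCell_le (hh : 0 < h) (x : Plane) (φ : Plane → ENNReal) :
    ∫⁻ q in gridCell h (gridIndex h x), φ q ≤ ∫⁻ s in gridBox h, φ (x + s) := by
  rw [← lintegral_indicator (measurableSet_gridCell h _),
    ← lintegral_indicator (measurableSet_gridBox h),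
    ← lintegral_add_left_eq_self _ x]
  gcongr with s
  by_cases hs : x + s ∈ gridCell h (gridIndex h x)
  · rw [indicator_of_mem hs, indicator_of_mem (mem_gridBox_of_gridIndex_add_eq hh hs)]
  · simp [indicator_of_notMem hs]

theorem eLpNorm_fderiv_apply_le {f : Plane → ℝ} (hf : ContDiff ℝ 1 f) {s : Plane}
    (hs : s ∈ gridBox h) :
    eLpNorm (fun x => fderiv ℝ f x s) 2 volume ≤
      ENNReal.ofReal h * ∑ j, eLpNorm (partialDeriv j f) 2 volume := by
  have hc (j : Fin 2) : Continuous (partialDeriv j f) :=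
    (hf.continuous_fderiv one_ne_zero).clm_apply continuous_const
  simp only [fderiv_apply_eq_sum_partialDeriv]
  refine (eLpNorm_sum_const_mul_le (by norm_num) _ _ fun j => (hc j).aestronglyMeasurable).trans ?_
  rw [Finset.mul_sum]
  gcongr with j
  rw [Real.enorm_eq_ofReal_abs]
  exact ENNReal.ofReal_le_ofReal (abs_lt.2 (hs j)).le

/-- A Poincaré inequality on each cell: the difference to the average over the cell is an average
of differences `f x - f (x + s)` with `s` of size at most `h`. -/
theorem eLpNorm_sub_average_gridCell_le (hh : 0 < h) {f : Plane → ℝ} (hf : ContDiff ℝ 1 f)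
    (hint : Integrable f) :
    eLpNorm (fun x => f x - ⨍ q in gridCell h (gridIndex h x), f q) 2 volume ≤
      ENNReal.ofReal (2 * h) * ∑ j, eLpNorm (partialDeriv j f) 2 volume := by
  set G := ∑ j, eLpNorm (partialDeriv j f) 2 volume
  have hh0 : ENNReal.ofReal h ^ 2 ≠ 0 := by simpa using hh
  have hcell (x : Plane) : ‖f x - ⨍ q in gridCell h (gridIndex h x), f q‖ₑ ^ 2 ≤
      (ENNReal.ofReal h ^ 2)⁻¹ * ∫⁻ s in gridBox h, ‖f (x + s) - f x‖ₑ ^ 2 := by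
    have hvol := volume_gridCell hh (gridIndex h x)
    have : IsFiniteMeasure (volume.restrict (gridCell h (gridIndex h x))) :=
      ⟨by simp [hvol]⟩
    have : NeZero (volume.restrict (gridCell h (gridIndex h x))) :=
      ⟨Measure.restrict_eq_zero.not.2 (by rwa [hvol])⟩
    refine (enorm_sub_average_sq_le hint.integrableOn (f x)).trans ?_
    rw [setLAverage_eq, hvol, ENNReal.div_eq_inv_mul]
    refine mul_le_mul_right ?_ _
    simpa only [enorm_sub_rev (f x)] using
      setLIntegral_gridCell_le hh x fun q => ‖f q - f x‖ₑ ^ 2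
  have hmeas : Measurable fun z : Plane × Plane => ‖f (z.1 + z.2) - f z.1‖ₑ ^ 2 :=
    Continuous.measurable (by have := hf.continuous; fun_prop)
  rw [← ENNReal.pow_le_pow_left_iff two_ne_zero, eLpNorm_two_sq]
  calc ∫⁻ x, ‖f x - ⨍ q in gridCell h (gridIndex h x), f q‖ₑ ^ 2
      ≤ ∫⁻ x, (ENNReal.ofReal h ^ 2)⁻¹ * ∫⁻ s in gridBox h, ‖f (x + s) - f x‖ₑ ^ 2 :=
        lintegral_mono hcell
    _ = (ENNReal.ofReal h ^ 2)⁻¹ * ∫⁻ s in gridBox h, ∫⁻ x, ‖f (x + s) - f x‖ₑ ^ 2 := by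
        rw [lintegral_const_mul _ hmeas.lintegral_prod_right',
          lintegral_lintegral_swap hmeas.aemeasurable]
    _ ≤ (ENNReal.ofReal h ^ 2)⁻¹ * ∫⁻ _ in gridBox h, (ENNReal.ofReal h * G) ^ 2 := by
        refine mul_le_mul_right ?_ _
        refine setLIntegral_mono measurable_const fun s hs => ?_
        refine (lintegral_enorm_translate_sub_sq_le hf s).trans ?_
        rw [← eLpNorm_two_sq]
        gcongr
        exact eLpNorm_fderiv_apply_le hf hs
    _ = (ENNReal.ofReal (2 * h) * G) ^ 2 := by
        rw [setLIntegral_const, volume_gridBox, mul_pow, mul_pow, ← mul_assoc, ← mul_assoc,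
          ENNReal.inv_mul_cancel hh0 (by finiteness), one_mul, mul_comm]

theorem finite_image_gridIndex (hh : 0 < h) {Ω : Set Plane} (hΩ : Bornology.IsBounded Ω) :
    (gridIndex h '' Ω).Finite := by
  obtain ⟨B, hB⟩ := hΩ.exists_norm_le
  refine (finite_Icc (fun _ : Fin 2 => ⌊-B / h⌋) fun _ => ⌊B / h⌋).subset ?_
  rintro _ ⟨x, hx, rfl⟩
  have hxi (i : Fin 2) := abs_le.1 ((PiLp.norm_apply_le x i).trans (hB x hx))
  constructor <;> intro i <;> dsimp only [gridIndex] <;> gcongr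
  exacts [(hxi i).1, (hxi i).2]

/-- Rellich's theorem: functions that are constant on the cells of a fine grid approximate all test
functions uniformly. -/
theorem exists_finiteDimensional_approx {Ω : Set Plane} (hΩm : MeasurableSet Ω)
    (hΩ : Bornology.IsBounded Ω) {ε : ℝ} (hε : 0 < ε) :
    ∃ F : Submodule ℝ (L2 Ω), FiniteDimensional ℝ F ∧ ∀ f, ∀ hf : IsTest Ω f,
      ∃ g ∈ F, ‖hf.toL2 Ω - g‖ ≤ ε * ∑ j, l2norm (partialDeriv j f) := by
  have : IsFiniteMeasure (volume.restrict Ω) := ⟨by simpa using hΩ.measure_lt_top⟩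
  set h := ε / 2 with h_def
  have hh : 0 < h := half_pos hε
  set T := (finite_image_gridIndex hh hΩ).toFinset
  let e (m : Fin 2 → ℤ) : L2 Ω :=
    indicatorConstLp 2 (measurableSet_gridCell h m) (measure_ne_top _ _) 1
  refine ⟨Submodule.span ℝ (e '' T), FiniteDimensional.span_of_finite ℝ (T.finite_toSet.image e),
    fun f hf => ?_⟩
  let c (m : Fin 2 → ℤ) : ℝ := ⨍ q in gridCell h m, f q
  refine ⟨∑ m ∈ T, c m • e m, Submodule.sum_mem _ fun m hm => Submodule.smul_mem _ _
    (Submodule.subset_span (mem_image_of_mem e hm)), ?_⟩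
  have hcoe : ⇑(∑ m ∈ T, c m • e m) =ᵐ[volume.restrict Ω] fun x => c (gridIndex h x) := by
    refine coeFn_sum_smul_indicatorConstLp_fiber (measurableSet_gridCell h) ?_ c
    filter_upwards [ae_restrict_mem hΩm] with x hx
    exact (Finite.mem_toFinset _).2 (mem_image_of_mem _ hx)
  have hdiff : ⇑(hf.toL2 Ω - ∑ m ∈ T, c m • e m) =ᵐ[volume.restrict Ω]
      fun x => f x - c (gridIndex h x) :=
    (Lp.coeFn_sub _ _).trans (hf.coeFn_toL2.sub hcoe)
  have hfin (j : Fin 2) : eLpNorm (partialDeriv j f) 2 volume ≠ ⊤ :=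
    (hf.partialDeriv j).eLpNorm_ne_top
  have hle := eLpNorm_sub_average_gridCell_le hh (hf.contDiff.of_le (by simp))
    (hf.contDiff.continuous.integrable_of_hasCompactSupport hf.hasCompactSupport)
  have := ENNReal.toReal_mono (ENNReal.mul_ne_top (by finiteness)
    (ENNReal.sum_ne_top.2 fun j _ => hfin j))
    ((eLpNorm_mono_measure _ (Measure.restrict_le_self (s := Ω))).trans hle)
  rw [ENNReal.toReal_mul, ENNReal.toReal_sum fun j _ => hfin j,
    ENNReal.toReal_ofReal (by positivity), h_def, mul_div_cancel₀ _ two_ne_zero] at this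
  rwa [Lp.norm_def, eLpNorm_congr_ae hdiff]

end Grid

/-! ### Functions with vanishing weak gradient -/

theorem exists_ae_eq_const_of_locally {X Y : Type*} [TopologicalSpace X] [SecondCountableTopology X]
    [MeasurableSpace X] {μ : Measure X} [μ.IsOpenPosMeasure] {U : Set X} (hU : IsConnected U)
    {f : X → Y} (hf : ∀ x ∈ U, ∃ c, ∃ V ∈ 𝓝 x, ∀ᵐ y ∂μ, y ∈ V → f y = c) :
    ∃ c, ∀ᵐ x ∂μ, x ∈ U → f x = c := by
  choose c V hV hc using fun x : U => hf x x.2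
  have hlc : IsLocallyConstant c := by
    refine (IsLocallyConstant.iff_eventually_eq c).2 fun x => ?_
    filter_upwards [continuous_subtype_val.continuousAt.eventually
      (eventually_mem_nhds_iff.2 (hV x))] with y hy
    by_contra hne
    refine (Measure.measure_pos_of_mem_nhds μ (inter_mem hy (hV y))).ne'
      (measure_eq_zero_iff_ae_notMem.2 ?_)
    filter_upwards [hc x, hc y] with z hx hy hz
    exact hne ((hy hz.2).symm.trans (hx hz.1))
  have := isPreconnected_iff_preconnectedSpace.1 hU.isPreconnected
  obtain ⟨x₀, hx₀⟩ := hU.nonempty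
  refine ⟨c ⟨x₀, hx₀⟩, ae_iff.2 (measure_null_of_locally_null _ fun x hx => ?_)⟩
  have hxU : x ∈ U := by
    by_contra h
    exact hx fun h' => absurd h' h
  refine ⟨_, inter_mem_nhdsWithin _ (hV ⟨x, hxU⟩), measure_mono_null ?_ (ae_iff.1 (hc ⟨x, hxU⟩))⟩
  rintro y ⟨hy, hyV⟩ hcy
  exact hy fun _ => (hcy hyV).trans (hlc.apply_eq_of_preconnectedSpace _ _)

section WeakGradient

variable {Ω : Set Plane} {q : Plane → ℝ}

theorem isTest_normed_const_sub (φ : ContDiffBump (0 : Plane)) {x : Plane}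
    (hx : Metric.closedBall x φ.rOut ⊆ Ω) : IsTest Ω fun y => φ.normed volume (x - y) := by
  refine ⟨φ.contDiff_normed.comp (contDiff_const.sub contDiff_id),
    φ.hasCompactSupport_normed.comp_homeomorph (Homeomorph.subLeft x),
    (closure_minimal (fun y hy => ?_) Metric.isClosed_closedBall).trans hx⟩
  have hxy : x - y ∈ Function.support (φ.normed volume) := hy
  rw [φ.support_normed_eq, mem_ball_zero_iff] at hxy
  rw [mem_closedBall_iff_norm']
  exact hxy.le

theorem partialDeriv_comp_const_sub {f : Plane → ℝ} (hf : Differentiable ℝ f) (x y : Plane)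
    (j : Fin 2) : partialDeriv j (fun z => f (x - z)) y = -partialDeriv j f (x - y) := by
  have h := (hf (x - y)).hasFDerivAt.comp y ((hasFDerivAt_id y).const_sub x)
  rw [partialDeriv, show (fun z => f (x - z)) = f ∘ fun z => x - z from rfl, h.fderiv]
  simp [partialDeriv]

theorem fderiv_bump_convolution_eq_zero (hq : LocallyIntegrable q volume)
    (hw : ∀ f, IsTest Ω f → ∀ j, ∫ x, q x * partialDeriv j f x = 0)
    (φ : ContDiffBump (0 : Plane)) {x : Plane} (hx : Metric.closedBall x φ.rOut ⊆ Ω) :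
    fderiv ℝ (convolution (φ.normed volume) q (ContinuousLinearMap.lsmul ℝ ℝ) volume) x = 0 := by
  set η := φ.normed volume
  have hηs : ContDiff ℝ ∞ η := φ.contDiff_normed
  have hηc : HasCompactSupport η := φ.hasCompactSupport_normed
  have hderiv := (hηc.hasFDerivAt_convolution_left (ContinuousLinearMap.lsmul ℝ ℝ)
    (hηs.of_le (by simp)) hq x).fderiv
  have hex : ConvolutionExistsAt (fderiv ℝ η) q x
      ((ContinuousLinearMap.lsmul ℝ ℝ).precompL Plane) volume :=
    (hηc.fderiv ℝ).convolutionExists_left _ (hηs.continuous_fderiv (by simp)) hq x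
  have hpartial (j : Fin 2) :
      partialDeriv j (convolution η q (ContinuousLinearMap.lsmul ℝ ℝ) volume) x = 0 := by
    rw [partialDeriv, hderiv, convolution_def, ContinuousLinearMap.integral_apply hex,
      ← integral_sub_left_eq_self _ volume x, ← neg_eq_zero, ← integral_neg,
      ← hw _ (isTest_normed_const_sub φ hx) j]
    refine integral_congr_ae (Eventually.of_forall fun y => ?_)
    simp only [sub_sub_cancel]
    rw [partialDeriv_comp_const_sub ((φ.contDiff_normed (n := ⊤)).differentiable (by simp))]
    simp [ContinuousLinearMap.precompL_apply, partialDeriv, η, mul_comm]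
  ext v
  simp only [fderiv_apply_eq_sum_partialDeriv, hpartial, mul_zero, Finset.sum_const_zero,
    zero_apply]

theorem bump_convolution_eq_on_ball (hq : LocallyIntegrable q volume)
    (hw : ∀ f, IsTest Ω f → ∀ j, ∫ x, q x * partialDeriv j f x = 0) {x₀ : Plane} {ρ : ℝ}
    (hB : Metric.ball x₀ (2 * ρ) ⊆ Ω) (φ : ContDiffBump (0 : Plane)) (hφ : φ.rOut < ρ)
    {x y : Plane} (hx : x ∈ Metric.ball x₀ ρ) (hy : y ∈ Metric.ball x₀ ρ) :
    convolution (φ.normed volume) q (ContinuousLinearMap.lsmul ℝ ℝ) volume x =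
      convolution (φ.normed volume) q (ContinuousLinearMap.lsmul ℝ ℝ) volume y := by
  refine Metric.isOpen_ball.is_const_of_fderiv_eq_zero (𝕜 := ℝ) (convex_ball x₀ ρ).isPreconnected
    (fun z _ => ?_) (fun z hz => ?_) hx hy
  · exact (φ.hasCompactSupport_normed.hasFDerivAt_convolution_left _ φ.contDiff_normed hq
      z).differentiableAt.differentiableWithinAt
  · refine fderiv_bump_convolution_eq_zero hq hw φ
      ((Metric.closedBall_subset_ball' ?_).trans hB)
    linarith [Metric.mem_ball.1 hz]

theorem exists_ae_eq_const_ball (hq : LocallyIntegrable q volume)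
    (hw : ∀ f, IsTest Ω f → ∀ j, ∫ x, q x * partialDeriv j f x = 0) {x₀ : Plane} {ρ : ℝ}
    (hρ : 0 < ρ) (hB : Metric.ball x₀ (2 * ρ) ⊆ Ω) :
    ∃ c : ℝ, ∀ᵐ x, x ∈ Metric.ball x₀ ρ → q x = c := by
  let φ : ℕ → ContDiffBump (0 : Plane) := fun n =>
    ⟨ρ / (2 * (n + 2)), ρ / (n + 2), by positivity, by gcongr; linarith⟩
  have hφ : Tendsto (fun n => (φ n).rOut) atTop (𝓝 0) :=
    (tendsto_atTop_add_const_right _ _ tendsto_natCast_atTop_atTop).const_div_atTop ρ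
  have hφρ (n : ℕ) : (φ n).rOut < ρ := div_lt_self hρ (by linarith [n.cast_nonneg (α := ℝ)])
  have hφK : ∀ᶠ n in atTop, (φ n).rOut ≤ 2 * (φ n).rIn := Eventually.of_forall fun n => by
    change ρ / (n + 2) ≤ 2 * (ρ / (2 * (n + 2)))
    exact le_of_eq (by field_simp)
  have hae := ContDiffBump.ae_convolution_tendsto_right_of_locallyIntegrable hφ hφK hq
  obtain ⟨x₁, hx₁B, hx₁⟩ : ∃ x₁ ∈ Metric.ball x₀ ρ, Tendsto (fun n => convolution
      ((φ n).normed volume) q (ContinuousLinearMap.lsmul ℝ ℝ) volume x₁) atTop (𝓝 (q x₁)) := by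
    have hfreq : ∃ᶠ x in ae volume, x ∈ Metric.ball x₀ ρ :=
      frequently_ae_mem_iff.2 (Metric.measure_ball_pos volume x₀ hρ).ne'
    exact (hfreq.and_eventually hae).exists
  refine ⟨q x₁, ?_⟩
  filter_upwards [hae] with x hx hxB
  refine tendsto_nhds_unique hx ?_
  simpa only [bump_convolution_eq_on_ball hq hw hB (φ _) (hφρ _) hxB hx₁B] using hx₁

theorem exists_ae_eq_const_of_weak_gradient_eq_zero (hΩo : IsOpen Ω) (hΩc : IsConnected Ω)
    (hq : LocallyIntegrable q volume)
    (hw : ∀ f, IsTest Ω f → ∀ j, ∫ x, q x * partialDeriv j f x = 0) :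
    ∃ c : ℝ, ∀ᵐ x, x ∈ Ω → q x = c := by
  refine exists_ae_eq_const_of_locally hΩc fun x hx => ?_
  obtain ⟨r, hr, hrΩ⟩ := Metric.isOpen_iff.1 hΩo x hx
  obtain ⟨c, hc⟩ := exists_ae_eq_const_ball hq hw (half_pos hr)
    (by rwa [mul_div_cancel₀ _ two_ne_zero])
  exact ⟨c, _, Metric.ball_mem_nhds x (half_pos hr), hc⟩

end WeakGradient

/-! ### The inf-sup condition -/

section ClosedRange

variable {X Y : Type*} [NormedAddCommGroup X] [NormedSpace ℝ X] [CompleteSpace X]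
  [NormedAddCommGroup Y] [NormedSpace ℝ Y] [CompleteSpace Y]

theorem exists_norm_le_mul_norm_apply_of_injective {T : X →L[ℝ] Y} (hT : Function.Injective T)
    {N : Submodule ℝ X} [N.CoFG] (hN : IsClosed (N : Set X)) {K : ℝ≥0}
    (hK : ∀ x ∈ N, ‖x‖ ≤ K * ‖T x‖) : ∃ β : ℝ≥0, ∀ x, ‖x‖ ≤ β * ‖T x‖ := by
  have closed_image : IsClosed (N.map (T : X →ₗ[ℝ] Y) : Set Y) := by
    have hanti : AntilipschitzWith K (T ∘L N.subtypeL) :=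
      AddMonoidHomClass.antilipschitz_of_bound _ fun x => hK x x.2
    have : CompleteSpace N := hN.completeSpace_coe
    convert hanti.isClosed_range (T ∘L N.subtypeL).uniformContinuous using 1
    ext y
    simp
  have closed_range : IsClosed (range T) :=
    LinearMap.isClosed_range_of_isClosed_map_of_finiteDimensional_quotient closed_image
  obtain ⟨β, hβ⟩ := T.antilipschitz_of_injective_of_isClosed_range hT closed_range
  exact ⟨β, ZeroHomClass.bound_of_antilipschitz T hβ⟩

theorem exists_norm_le_mul_of_forall_le {V Z : Type*} [NormedAddCommGroup V] [NormedSpace ℝ V]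
    [NormedAddCommGroup Z] [NormedSpace ℝ Z] [CompleteSpace Z] {A : X →L[ℝ] StrongDual ℝ V}
    {G : X →L[ℝ] Z} (hAG : ∀ x, A x = 0 → G x = 0 → x = 0) {N : Submodule ℝ X} [N.CoFG]
    (hN : IsClosed (N : Set X)) {K : ℝ≥0}
    (hK : ∀ x ∈ N, ∀ M, 0 ≤ M → (∀ v, A x v ≤ M * ‖v‖) → ‖x‖ ≤ K * M) :
    ∃ β : ℝ≥0, ∀ x M, G x = 0 → 0 ≤ M → (∀ v, A x v ≤ M * ‖v‖) → ‖x‖ ≤ β * M := by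
  have hT : Function.Injective (A.prod G) := (injective_iff_map_eq_zero _).2 fun x hx =>
    hAG x (congrArg Prod.fst hx) (congrArg Prod.snd hx)
  have hKT : ∀ x ∈ N, ‖x‖ ≤ K * ‖A.prod G x‖ := fun x hx =>
    (hK x hx ‖A x‖ (norm_nonneg _) fun v => (le_abs_self _).trans ((A x).le_opNorm v)).trans
      (mul_le_mul_of_nonneg_left (norm_fst_le (A.prod G x)) K.2)
  obtain ⟨β, hβ⟩ := exists_norm_le_mul_norm_apply_of_injective hT hN hKT
  refine ⟨β, fun x M hG hM hxM => (hβ x).trans (mul_le_mul_of_nonneg_left ?_ β.2)⟩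
  have hAx : ‖A x‖ ≤ M := ContinuousLinearMap.opNorm_le_bound _ hM fun v =>
    abs_le'.2 ⟨hxM v, by simpa using hxM (-v)⟩
  simpa [hG, Prod.norm_def] using hAx

end ClosedRange

section Divergence

variable {Ω : Set Plane}

theorem norm_comp_le (v : Velocity Ω) (i : Fin 2) : ‖v.comp i‖ ≤ ‖v‖ :=
  (norm_fst_le _).trans (norm_le_pi_norm v i)

theorem norm_grad_le (v : Velocity Ω) (i j : Fin 2) : ‖v.grad i j‖ ≤ ‖v‖ :=
  ((norm_le_pi_norm _ j).trans (norm_snd_le _)).trans (norm_le_pi_norm v i)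

theorem norm1_le (v : Velocity Ω) : norm1 v ≤ 3 * ‖v‖ := by
  refine le_of_sq_le_sq ?_ (by positivity)
  rw [norm1_sq, rForm_self_eq, aForm_self_eq]
  calc _ ≤ (∑ _i : Fin 2, ‖v‖ ^ 2) + ∑ _i : Fin 2, ∑ _j : Fin 2, ‖v‖ ^ 2 := by
        gcongr with i _ i _ j _
        exacts [norm_comp_le v i, norm_grad_le v i j]
    _ ≤ (3 * ‖v‖) ^ 2 := by
        simp only [Fin.sum_univ_two]
        nlinarith [sq_nonneg ‖v‖]

theorem norm_bBilin_le (v : Velocity Ω) (p : L2 Ω) : ‖bBilin Ω v p‖ ≤ 2 * ‖v‖ * ‖p‖ := by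
  rw [bBilin_apply]
  refine (norm_sum_le _ _).trans ?_
  calc _ ≤ ∑ _i : Fin 2, ‖v‖ * ‖p‖ := Finset.sum_le_sum fun i _ =>
        (norm_inner_le_norm _ _).trans (by gcongr; exact norm_grad_le v i i)
    _ = 2 * ‖v‖ * ‖p‖ := by rw [Fin.sum_univ_two]; ring

theorem exists_norm_testVelocity_le (hΩ : Bornology.IsBounded Ω) :
    ∃ C : ℝ≥0, ∀ (v : Fin 2 → Plane → ℝ) (hv : ∀ i, IsTest Ω (v i)) (B : ℝ),
      (∀ i j, l2norm (partialDeriv j (v i)) ≤ B) → ‖testVelocity hv‖ ≤ C * B := by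
  obtain ⟨C, hC⟩ := exists_l2norm_le_sum_partialDeriv hΩ
  refine ⟨2 * C + 1, fun v hv B hB => ?_⟩
  have hB0 : 0 ≤ B := (l2norm_nonneg _).trans (hB 0 0)
  have hgrad : B ≤ ↑(2 * C + 1) * B := by
    push_cast
    nlinarith [mul_nonneg C.2 hB0]
  refine (pi_norm_le_iff_of_nonneg (by positivity)).2 fun i => max_le ?_
    ((pi_norm_le_iff_of_nonneg (by positivity)).2 fun j => ?_)
  · calc _ = l2norm (v i) := (hv i).norm_toL2
      _ ≤ C * ∑ j, l2norm (partialDeriv j (v i)) := hC _ (hv i)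
      _ ≤ C * ∑ _j : Fin 2, B := by gcongr with j; exact hB i j
      _ ≤ ↑(2 * C + 1) * B := by
        rw [Fin.sum_univ_two]
        push_cast
        linarith
  · exact (((hv i).partialDeriv j).norm_toL2.trans_le (hB i j)).trans hgrad

end Divergence

section Necas

variable {Ω : Set Plane}

theorem norm_le_sum_eLpNorm_inter (hΩ : MeasurableSet Ω) (p : L2 Ω) {ι : Type*} (t : Finset ι)
    {B : ι → Set Plane} (hBm : ∀ i, MeasurableSet (B i)) (hB : Ω ⊆ ⋃ i ∈ t, B i) :
    ‖p‖ ≤ ∑ i ∈ t, (eLpNorm p 2 (volume.restrict (Ω ∩ B i))).toReal := by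
  have hfin (i : ι) : eLpNorm p 2 (volume.restrict (Ω ∩ B i)) ≠ ⊤ :=
    ((Lp.memLp p).mono_measure (Measure.restrict_mono_set volume inter_subset_left)).2.ne
  rw [Lp.norm_def, ← ENNReal.toReal_sum fun i _ => hfin i]
  refine ENNReal.toReal_mono (ENNReal.sum_lt_top.2 fun i _ => (hfin i).lt_top).ne ?_
  have hind (i : ι) : eLpNorm ((B i).indicator fun x => ‖p x‖) 2 (volume.restrict Ω) =
      eLpNorm p 2 (volume.restrict (Ω ∩ B i)) := by
    rw [eLpNorm_indicator_eq_eLpNorm_restrict (hBm i), Measure.restrict_restrict (hBm i),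
      inter_comm, eLpNorm_norm]
  have hpoint : ∀ x ∈ Ω, ‖p x‖ ≤ ‖(∑ i ∈ t, (B i).indicator fun x => ‖p x‖) x‖ := fun x hx => by
    obtain ⟨i, hi, hxi⟩ := mem_iUnion₂.1 (hB hx)
    rw [Finset.sum_apply]
    calc ‖p x‖ = (B i).indicator (fun x => ‖p x‖) x := (indicator_of_mem hxi (fun x => ‖p x‖)).symm
      _ ≤ ∑ i ∈ t, (B i).indicator (fun x => ‖p x‖) x := Finset.single_le_sum
          (f := fun i => (B i).indicator (fun x => ‖p x‖) x)
          (fun _ _ => indicator_nonneg (fun _ _ => norm_nonneg _) _) hi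
      _ ≤ _ := le_abs_self _
  calc eLpNorm p 2 (volume.restrict Ω)
      ≤ eLpNorm (∑ i ∈ t, (B i).indicator fun x => ‖p x‖) 2 (volume.restrict Ω) :=
        eLpNorm_mono_ae ((ae_restrict_mem hΩ).mono hpoint)
    _ ≤ ∑ i ∈ t, eLpNorm ((B i).indicator fun x => ‖p x‖) 2 (volume.restrict Ω) :=
        eLpNorm_sum_le (fun i _ => (Lp.memLp p).1.norm.indicator (hBm i)) (by norm_num)
    _ = _ := Finset.sum_congr rfl fun i _ => hind i

theorem setIntegral_mul_eq_bForm_sub {B : Set Plane} {f R : Plane → ℝ}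
    {v : Fin 2 → Plane → ℝ} (hΩ : MeasurableSet Ω) (p : L2 Ω) (hf : IsTest (Ω ∩ B) f)
    (hv : ∀ i, IsTest Ω (v i)) (hR : IsTest Ω R)
    (hdiv : ∀ x, ∑ i, partialDeriv i (v i) x = f x + R x) :
    ∫ x in Ω ∩ B, p x * f x = bForm (testVelocity hv) p - ∫ x in Ω, p x * R x := by
  have hsupport : ∫ x in Ω ∩ B, p x * f x = ∫ x in Ω, p x * f x :=
    (setIntegral_eq_of_subset_of_forall_sdiff_eq_zero hΩ inter_subset_left fun x hx => by
      rw [image_eq_zero_of_notMem_tsupport fun h => hx.2 (hf.tsupport_subset h), mul_zero]).symm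
  have hint {g : Plane → ℝ} {U : Set Plane} (hg : IsTest U g) :
      Integrable (fun x => p x * g x) (volume.restrict Ω) :=
    (Lp.memLp p).integrable_mul (hg.memLp _)
  simp_rw [hsupport, bForm_testVelocity hv p, hdiv, mul_add]
  rw [integral_add (hint hf) (hint hR), add_sub_cancel_right]

/-- The duality bounds say that `∇p` and `p` have norms at most `M` and `N` in `H⁻¹(Ω)`. -/
theorem exists_toReal_eLpNorm_inter_ball_le (hΩ : IsBoundedLipschitzDomain Ω) {x₀ : Plane}
    (hx₀ : x₀ ∈ closure Ω) : ∃ ρ : ℝ, 0 < ρ ∧ ∃ C : ℝ≥0, ∀ (p : L2 Ω) (M N : ℝ), 0 ≤ M → 0 ≤ N →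
      (∀ v : Velocity Ω, bForm v p ≤ M * ‖v‖) →
      (∀ f, IsTest Ω f → |∫ x in Ω, p x * f x| ≤ N * ∑ j, l2norm (partialDeriv j f)) →
      (eLpNorm p 2 (volume.restrict (Ω ∩ Metric.ball x₀ ρ))).toReal ≤
        C * (M + N) := by
  obtain ⟨r, τ, L, hr, hτ, hcone⟩ := hΩ.exists_hasCone hx₀
  obtain ⟨S, hS⟩ := hcone.exists_local_solver hr hτ
  obtain ⟨V, hV⟩ := exists_norm_testVelocity_le hΩ.isBounded
  refine ⟨r / 2, half_pos hr, S * (V + 2), fun p M N hM hN hpM hpN => ?_⟩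
  refine toReal_eLpNorm_le_of_integral_test_le (hΩ.isOpen.inter Metric.isOpen_ball)
    ((Lp.memLp p).mono_measure (Measure.restrict_mono_set volume inter_subset_left))
    (by positivity) fun f hf => ?_
  obtain ⟨v, R, hv, hR, hdiv, hvS, hRS⟩ := hS f hf
  have hvelocity : bForm (testVelocity hv) p ≤ M * (V * (S * l2norm f)) :=
    (hpM _).trans <| mul_le_mul_of_nonneg_left
      (hV v hv _ fun i j => hf.l2norm_le_of_eLpNorm_le (hvS i j)) hM
  have hremainder : |∫ x in Ω, p x * R x| ≤ N * (2 * (S * l2norm f)) := by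
    refine (hpN R hR).trans (mul_le_mul_of_nonneg_left ?_ hN)
    rw [Fin.sum_univ_two, two_mul]
    exact add_le_add (hf.l2norm_le_of_eLpNorm_le (hRS 0)) (hf.l2norm_le_of_eLpNorm_le (hRS 1))
  have hSf : 0 ≤ S * l2norm f := mul_nonneg S.2 (l2norm_nonneg f)
  calc ∫ x in Ω ∩ Metric.ball x₀ (r / 2), p x * f x
      = bForm (testVelocity hv) p - ∫ x in Ω, p x * R x :=
        setIntegral_mul_eq_bForm_sub hΩ.isOpen.measurableSet p hf hv hR hdiv
    _ ≤ M * (V * (S * l2norm f)) + N * (2 * (S * l2norm f)) := by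
        linarith [neg_abs_le (∫ x in Ω, p x * R x)]
    _ ≤ S * (V + 2) * (M + N) * l2norm f := by
        linarith [mul_nonneg hSf hM, mul_nonneg hSf (mul_nonneg V.coe_nonneg hN)]

theorem exists_necas_inequality (hΩ : IsBoundedLipschitzDomain Ω) :
    ∃ C : ℝ≥0, ∀ (p : L2 Ω) (M N : ℝ), 0 ≤ M → 0 ≤ N →
      (∀ v : Velocity Ω, bForm v p ≤ M * ‖v‖) →
      (∀ f, IsTest Ω f → |∫ x in Ω, p x * f x| ≤ N * ∑ j, l2norm (partialDeriv j f)) →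
      ‖p‖ ≤ C * (M + N) := by
  choose! ρ hρ C hC using fun x (hx : x ∈ closure Ω) =>
    exists_toReal_eLpNorm_inter_ball_le hΩ hx
  obtain ⟨t, htΩ, ht⟩ := hΩ.isBounded.isCompact_closure.elim_nhds_subcover
    (fun x => Metric.ball x (ρ x)) fun x hx => Metric.ball_mem_nhds x (hρ x hx)
  refine ⟨∑ x ∈ t, C x, fun p M N hM hN hpM hpN => ?_⟩
  calc ‖p‖ ≤ ∑ x ∈ t, (eLpNorm p 2 (volume.restrict (Ω ∩ Metric.ball x (ρ x)))).toReal :=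
        norm_le_sum_eLpNorm_inter hΩ.isOpen.measurableSet p t
          (fun _ => Metric.isOpen_ball.measurableSet) (subset_closure.trans ht)
    _ ≤ ∑ x ∈ t, C x * (M + N) :=
        Finset.sum_le_sum fun x hx => hC x (htΩ x hx) p M N hM hN hpM hpN
    _ = (∑ x ∈ t, C x : ℝ≥0) * (M + N) := by rw [NNReal.coe_sum, Finset.sum_mul]

theorem exists_norm_le_of_mem_orthogonal (hΩ : IsBoundedLipschitzDomain Ω) :
    ∃ F : Submodule ℝ (L2 Ω), FiniteDimensional ℝ F ∧ ∃ K : ℝ≥0, ∀ p ∈ Fᗮ, ∀ M, 0 ≤ M →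
      (∀ v : Velocity Ω, bForm v p ≤ M * ‖v‖) → ‖p‖ ≤ K * M := by
  obtain ⟨C, hC⟩ := exists_necas_inequality hΩ
  obtain ⟨ε, hε, habsorb⟩ : ∃ ε : ℝ, 0 < ε ∧ C * ε ≤ 1 / 2 := by
    refine ⟨1 / (2 * (C + 1)), by positivity, ?_⟩
    rw [mul_one_div, div_le_div_iff₀ (by positivity) two_pos]
    linarith
  obtain ⟨F, hF, happrox⟩ :=
    exists_finiteDimensional_approx hΩ.isOpen.measurableSet hΩ.isBounded hε
  refine ⟨F, hF, 2 * C, fun p hp M hM hpM => ?_⟩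
  have hdual : ∀ f, IsTest Ω f →
      |∫ x in Ω, p x * f x| ≤ ε * ‖p‖ * ∑ j, l2norm (partialDeriv j f) := by
    intro f hf
    obtain ⟨g, hg, hfg⟩ := happrox f hf
    calc |∫ x in Ω, p x * f x| = |inner ℝ (hf.toL2 Ω - g) p| := by
          rw [inner_sub_left, hp g hg, sub_zero, hf.inner_toL2]
      _ ≤ ‖hf.toL2 Ω - g‖ * ‖p‖ := abs_real_inner_le_norm _ _
      _ ≤ ε * (∑ j, l2norm (partialDeriv j f)) * ‖p‖ := by gcongr
      _ = _ := by ring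
  have hnecas := hC p M (ε * ‖p‖) hM (by positivity) hpM hdual
  push_cast
  linarith [mul_le_mul_of_nonneg_right habsorb (norm_nonneg p)]

end Necas

section InfSup

variable {Ω : Set Plane}

variable (Ω) in
/-- The weak gradient `-∇ : L²(Ω) → 𝐕'`, `p ↦ b(·, p)`. The dual norm is the one for the norm that
`𝐕` has as a subspace of a product of copies of `L²(Ω)`; it is equivalent to the one for
`‖·‖₁`. -/
def weakGrad : L2 Ω →L[ℝ] StrongDual ℝ (Velocity Ω) :=
  (bBilin Ω).flip.mkContinuous₂ 2 fun p v => (norm_bBilin_le v p).trans_eq (by ring)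

theorem weakGrad_apply (p : L2 Ω) (v : Velocity Ω) : weakGrad Ω p v = bForm v p :=
  (bForm_eq_bBilin v p).symm

theorem integral_mul_partialDeriv_eq_zero {p : L2 Ω} (hp : weakGrad Ω p = 0) {f : Plane → ℝ}
    (hf : IsTest Ω f) (j : Fin 2) : ∫ x in Ω, p x * partialDeriv j f x = 0 := by
  have hv (i : Fin 2) : IsTest Ω ((Pi.single j f : Fin 2 → Plane → ℝ) i) := by
    rcases eq_or_ne i j with rfl | hij
    · simpa using hf
    · rw [Pi.single_eq_of_ne hij]
      exact IsTest.zero Ω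
  have hdiv (x : Plane) :
      ∑ i, partialDeriv i ((Pi.single j f : Fin 2 → Plane → ℝ) i) x = partialDeriv j f x := by
    rw [Finset.sum_eq_single j]
    · simp
    · intro i _ hij
      simp [hij, partialDeriv]
    · simp
  simpa [← weakGrad_apply, hp, hdiv] using (bForm_testVelocity hv p).symm

theorem exists_ae_eq_const_of_weakGrad_eq_zero (hΩ : IsBoundedLipschitzDomain Ω) {p : L2 Ω}
    (hp : weakGrad Ω p = 0) : ∃ c : ℝ, p =ᵐ[volume.restrict Ω] fun _ => c := by
  have hfin : IsFiniteMeasure (volume.restrict Ω) := ⟨by simpa using hΩ.isBounded.measure_lt_top⟩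
  have hms := hΩ.isOpen.measurableSet
  have hint : LocallyIntegrable (Ω.indicator p) volume :=
    ((integrable_indicator_iff hms).2 ((Lp.memLp p).integrable (by norm_num))).locallyIntegrable
  obtain ⟨c, hc⟩ := exists_ae_eq_const_of_weak_gradient_eq_zero hΩ.isOpen hΩ.isConnected hint
    fun f hf j => by
      simp_rw [← indicator_mul_left]
      rw [integral_indicator hms, integral_mul_partialDeriv_eq_zero hp hf j]
  refine ⟨c, (ae_restrict_iff' hms).2 (hc.mono fun x hx hxΩ => ?_)⟩
  rw [← hx hxΩ, indicator_of_mem hxΩ]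

theorem eq_zero_of_weakGrad_eq_zero (hΩ : IsBoundedLipschitzDomain Ω) {p : L2 Ω}
    (hp : weakGrad Ω p = 0) (hp0 : IsMeanZero p) : p = 0 := by
  obtain ⟨c, hc⟩ := exists_ae_eq_const_of_weakGrad_eq_zero hΩ hp
  have hvol : volume.real Ω ≠ 0 := ENNReal.toReal_ne_zero.2
    ⟨(hΩ.isOpen.measure_pos volume hΩ.isConnected.nonempty).ne',
      hΩ.isBounded.measure_lt_top.ne⟩
  have hc0 : c = 0 := by
    rw [IsMeanZero, integral_congr_ae hc, setIntegral_const, smul_eq_mul] at hp0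
    exact (mul_eq_zero.1 hp0).resolve_left hvol
  rw [hc0] at hc
  exact Lp.eq_zero_iff_ae_eq_zero.2 hc

theorem exists_isMeanZero_iff_inner_eq_zero (hΩ : volume Ω ≠ ⊤) :
    ∃ e : L2 Ω, ∀ p, IsMeanZero p ↔ inner ℝ e p = 0 := by
  have : IsFiniteMeasure (volume.restrict Ω) := ⟨by simpa using hΩ.lt_top⟩
  refine ⟨indicatorConstLp 2 MeasurableSet.univ (measure_ne_top _ _) (1 : ℝ), fun p => ?_⟩
  rw [L2.inner_indicatorConstLp_one, setIntegral_univ, IsMeanZero]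

theorem exists_infSupCondition (hΩ : IsBoundedLipschitzDomain Ω) :
    ∃ β, 0 < β ∧ InfSupCondition Ω β := by
  obtain ⟨F, hF, K, hK⟩ := exists_norm_le_of_mem_orthogonal hΩ
  obtain ⟨e, he⟩ := exists_isMeanZero_iff_inner_eq_zero hΩ.isBounded.measure_lt_top.ne
  have hcofg : Fᗮ.CoFG := Submodule.FG.cofg_of_isCompl
    F.isCompl_orthogonal (Module.Finite.iff_fg.1 hF)
  obtain ⟨β, hβ⟩ := exists_norm_le_mul_of_forall_le (A := weakGrad Ω) (G := innerSL ℝ e)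
    (fun p hp hp0 => eq_zero_of_weakGrad_eq_zero hΩ hp ((he p).2 hp0))
    F.isClosed_orthogonal (by simpa only [weakGrad_apply] using hK)
  refine ⟨3 * β + 1, by positivity, fun p M hp hM hpM => ?_⟩
  have hdual (v : Velocity Ω) : weakGrad Ω p v ≤ 3 * M * ‖v‖ := by
    rw [weakGrad_apply]
    calc bForm v p ≤ M * norm1 v := hpM v
      _ ≤ M * (3 * ‖v‖) := by gcongr; exact norm1_le v
      _ = 3 * M * ‖v‖ := by ring
  calc ‖p‖ ≤ β * (3 * M) := hβ p _ ((he p).1 hp) (by positivity) hdual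
    _ ≤ (3 * β + 1) * M := by linarith

end InfSup

/-! ### Error estimates -/

section Estimates

variable {Ω : Set Plane} {P β η lam lamh : ℝ} {u uh ut w : Velocity Ω} {p pt q : L2 Ω}

theorem norm1_le_of_aForm_le (hP0 : 0 ≤ P) (hP : PoincareInequality Ω P) (hη : 0 ≤ η)
    (hw : aForm w w ≤ η * norm1 w) : norm1 w ≤ P * η := by
  rcases (norm1_nonneg w).eq_or_lt with h0 | hpos
  · rw [← h0]; positivity
  · refine le_of_mul_le_mul_right ?_ hpos
    calc norm1 w * norm1 w = norm1 w ^ 2 := (sq _).symm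
      _ ≤ P * aForm w w := hP w
      _ ≤ P * (η * norm1 w) := by gcongr
      _ = P * η * norm1 w := by ring

theorem stokes_stability (hP0 : 0 ≤ P) (hP : PoincareInequality Ω P)
    (hβ : InfSupCondition Ω β) (hη : 0 ≤ η) (hq : IsMeanZero q) (hwq : bForm w q = 0)
    (hload : ∀ v : Velocity Ω, |aForm w v - bForm v q| ≤ η * norm1 v) :
    norm1 w + ‖q‖ ≤ (P + β * (P + 1)) * η := by
  have hw : norm1 w ≤ P * η := by
    refine norm1_le_of_aForm_le hP0 hP hη ?_
    simpa [hwq] using (le_abs_self _).trans (hload w)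
  have hqM : ‖q‖ ≤ β * ((P + 1) * η) := by
    refine hβ q _ hq (by positivity) fun v => ?_
    calc bForm v q ≤ |aForm w v| + |aForm w v - bForm v q| := by
          linarith [le_abs_self (aForm w v), neg_abs_le (aForm w v - bForm v q)]
      _ ≤ norm1 w * norm1 v + η * norm1 v := add_le_add (abs_aForm_le w v) (hload v)
      _ ≤ P * η * norm1 v + η * norm1 v := by gcongr; exact norm1_nonneg v
      _ = (P + 1) * η * norm1 v := by ring
  linarith

theorem IsMeanZero.sub (hΩ : Bornology.IsBounded Ω) (hp : IsMeanZero p) (hq : IsMeanZero q) :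
    IsMeanZero (p - q) := by
  have : IsFiniteMeasure (volume.restrict Ω) := ⟨by simpa using hΩ.measure_lt_top⟩
  have hint (f : L2 Ω) : Integrable f (volume.restrict Ω) := (Lp.memLp f).integrable (by norm_num)
  rw [IsMeanZero, integral_congr_ae (Lp.coeFn_sub p q)]
  simp only [Pi.sub_apply]
  rw [integral_sub (hint p) (hint q), hp, hq, sub_zero]

theorem abs_load_sub_load_le (huh : rForm uh uh ≤ 1) (v : Velocity Ω) :
    |lam * rForm u v - lamh * rForm uh v| ≤
      (|lam| + 1) * (normNeg1 (u - uh) + |lam - lamh|) * norm1 v := by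
  have hsplit : lam * rForm u v - lamh * rForm uh v =
      lam * rForm (u - uh) v + (lam - lamh) * rForm uh v := by
    simp only [rForm_eq_rBilin, map_sub, LinearMap.sub_apply]
    ring
  have huhv : |rForm uh v| ≤ norm1 v :=
    (abs_rForm_le uh v).trans (mul_le_of_le_one_left (norm1_nonneg v) (Real.sqrt_le_one.2 huh))
  calc |lam * rForm u v - lamh * rForm uh v|
      ≤ |lam| * |rForm (u - uh) v| + |lam - lamh| * |rForm uh v| := by
        rw [hsplit, ← abs_mul, ← abs_mul]; exact abs_add_le _ _
    _ ≤ |lam| * (normNeg1 (u - uh) * norm1 v) + |lam - lamh| * norm1 v := by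
        gcongr; exact abs_rForm_le_normNeg1_mul _ _
    _ ≤ (|lam| + 1) * (normNeg1 (u - uh) + |lam - lamh|) * norm1 v := by
        have := normNeg1_nonneg (u - uh)
        have := norm1_nonneg v
        nlinarith [mul_nonneg (abs_nonneg lam) (abs_nonneg (lam - lamh)),
          mul_nonneg (normNeg1_nonneg (u - uh)) (norm1_nonneg v)]

theorem velocity_pressure_error (hΩ : Bornology.IsBounded Ω) (hP0 : 0 ≤ P)
    (hP : PoincareInequality Ω P) (hβ : InfSupCondition Ω β) (h : IsStokesEigen u p lam)
    (huh : rForm uh uh ≤ 1) (ht : IsStokesSource lamh uh ut pt) :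
    norm1 (u - ut) + ‖p - pt‖ ≤
      (P + β * (P + 1)) * (|lam| + 1) * (normNeg1 (u - uh) + |lam - lamh|) := by
  have hmean : IsMeanZero (p - pt) := h.mean_zero.sub hΩ ht.mean_zero
  have hdiv : bForm (u - ut) (p - pt : L2 Ω) = 0 := by
    have hu := h.divergence _ hmean
    have hut := ht.divergence _ hmean
    rw [bForm_eq_bBilin] at hu hut ⊢
    rw [map_sub (bBilin Ω) u ut, LinearMap.sub_apply, hu, hut, sub_zero]
  have hmom (v : Velocity Ω) : aForm (u - ut) v - bForm v (p - pt : L2 Ω) =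
      lam * rForm u v - lamh * rForm uh v := by
    rw [← h.momentum, ← ht.momentum]
    simp only [aForm_eq_aBilin, bForm_eq_bBilin, map_sub, LinearMap.sub_apply]
    ring
  have hη : 0 ≤ (|lam| + 1) * (normNeg1 (u - uh) + |lam - lamh|) := by
    have := normNeg1_nonneg (u - uh)
    positivity
  rw [mul_assoc]
  refine stokes_stability hP0 hP hβ hη hmean hdiv fun v => ?_
  rw [hmom]
  exact abs_load_sub_load_le huh v

theorem aForm_sub_eigenvalue_mul_rForm (h : IsStokesEigen u p lam)
    (ht : IsStokesSource lamh uh ut pt) :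
    aForm ut ut - lam * rForm ut ut =
      aForm (u - ut) (u - ut) - lam * rForm (u - ut) (u - ut) := by
  have huu := h.momentum u
  have hut := h.momentum ut
  rw [h.divergence p h.mean_zero, sub_zero] at huu
  rw [ht.divergence p h.mean_zero, sub_zero] at hut
  simp only [aForm_eq_aBilin, rForm_eq_rBilin] at *
  exact bilin_sub_mul_eq_of_eigenvector (isPosSemidef_aBilin Ω).isSymm
    (isPosSemidef_rBilin Ω).isSymm huu hut

theorem quarter_le_rForm_self (hu : rForm u u = 1) (hut : norm1 (u - ut) ≤ 1 / 2) :
    1 / 4 ≤ rForm ut ut := by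
  have hsub : rForm (u - ut) (u - ut) ≤ 1 / 4 := by
    nlinarith [norm1_sq (u - ut), aForm_self_nonneg (u - ut), norm1_nonneg (u - ut)]
  rw [rForm_eq_rBilin] at *
  exact quarter_le_bilin_self (isPosSemidef_rBilin Ω) hu hsub

theorem abs_aForm_sub_mul_rForm_le (lam : ℝ) (w : Velocity Ω) :
    |aForm w w - lam * rForm w w| ≤ (|lam| + 1) * norm1 w ^ 2 := by
  have ha := aForm_self_nonneg w
  have hr := rForm_self_nonneg w
  calc |aForm w w - lam * rForm w w| ≤ |aForm w w| + |lam * rForm w w| := abs_sub _ _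
    _ = aForm w w + |lam| * rForm w w := by rw [abs_of_nonneg ha, abs_mul, abs_of_nonneg hr]
    _ ≤ (|lam| + 1) * (rForm w w + aForm w w) := by
        nlinarith [mul_nonneg (abs_nonneg lam) ha]
    _ = (|lam| + 1) * norm1 w ^ 2 := by rw [norm1_sq]

theorem abs_rayleigh_sub_le (h : IsStokesEigen u p lam) (ht : IsStokesSource lamh uh ut pt)
    (hut : norm1 (u - ut) ≤ 1 / 2) :
    |rayleigh ut - lam| ≤ 4 * (|lam| + 1) * norm1 (u - ut) ^ 2 := by
  have hr := quarter_le_rForm_self h.normalized hut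
  have hr0 : 0 < rForm ut ut := by linarith
  have hquot : rayleigh ut - lam = (aForm ut ut - lam * rForm ut ut) / rForm ut ut := by
    rw [rayleigh, sub_div, mul_div_cancel_right₀ _ hr0.ne']
  rw [hquot, abs_div, abs_of_pos hr0, div_le_iff₀ hr0, aForm_sub_eigenvalue_mul_rForm h ht]
  calc |aForm (u - ut) (u - ut) - lam * rForm (u - ut) (u - ut)|
      ≤ (|lam| + 1) * norm1 (u - ut) ^ 2 := abs_aForm_sub_mul_rForm_le lam (u - ut)
    _ = 4 * (|lam| + 1) * norm1 (u - ut) ^ 2 * (1 / 4) := by ring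
    _ ≤ 4 * (|lam| + 1) * norm1 (u - ut) ^ 2 * rForm ut ut := by gcongr

theorem ne_zero_of_norm1_sub_le (hu : rForm u u = 1) (hut : norm1 (u - ut) ≤ 1 / 2) : ut ≠ 0 := by
  rintro rfl
  have hr := quarter_le_rForm_self hu hut
  simp only [rForm_eq_rBilin, map_zero] at hr
  norm_num at hr

theorem exists_error_constants (hΩ : Bornology.IsBounded Ω) (hP0 : 0 < P) (hβ0 : 0 < β)
    (hP : PoincareInequality Ω P) (hβ : InfSupCondition Ω β) (lam : ℝ) :
    ∃ C δ : ℝ, 0 < C ∧ 0 < δ ∧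
      ∀ (u : Velocity Ω) (p : L2 Ω), IsStokesEigen u p lam →
      ∀ (uh : Velocity Ω) (lamh : ℝ), rForm uh uh ≤ 1 →
      ∀ (ut : Velocity Ω) (pt : L2 Ω), IsStokesSource lamh uh ut pt →
        norm1 (u - ut) + ‖p - pt‖ ≤ C * (normNeg1 (u - uh) + |lam - lamh|) ∧
        (normNeg1 (u - uh) + |lam - lamh| ≤ δ →
          ut ≠ 0 ∧
          |rayleigh ut - lam| ≤ C * (normNeg1 (u - uh) ^ 2 + |lam - lamh| ^ 2)) := by
  set K := (P + β * (P + 1)) * (|lam| + 1)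
  have hK : 0 < K := by positivity
  refine ⟨K + 8 * (|lam| + 1) * K ^ 2, 1 / (2 * K), by positivity, by positivity,
    fun u p h uh lamh huh ut pt ht => ?_⟩
  set X := normNeg1 (u - uh)
  set Y := |lam - lamh|
  have hXY : 0 ≤ X + Y := add_nonneg (normNeg1_nonneg _) (abs_nonneg _)
  have hlinear : norm1 (u - ut) + ‖p - pt‖ ≤ K * (X + Y) :=
    velocity_pressure_error hΩ hP0.le hP hβ h huh ht
  have hvelocity : norm1 (u - ut) ≤ K * (X + Y) :=
    (le_add_of_nonneg_right (norm_nonneg _)).trans hlinear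
  refine ⟨hlinear.trans (by gcongr; exact le_add_of_nonneg_right (by positivity)), fun hs => ?_⟩
  have hhalf : norm1 (u - ut) ≤ 1 / 2 := by
    calc norm1 (u - ut) ≤ K * (1 / (2 * K)) := hvelocity.trans (by gcongr)
      _ = 1 / 2 := by field_simp
  refine ⟨ne_zero_of_norm1_sub_le h.normalized hhalf, ?_⟩
  calc |rayleigh ut - lam| ≤ 4 * (|lam| + 1) * norm1 (u - ut) ^ 2 := abs_rayleigh_sub_le h ht hhalf
    _ ≤ 4 * (|lam| + 1) * (K * (X + Y)) ^ 2 := by gcongr; exact norm1_nonneg _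
    _ ≤ 4 * (|lam| + 1) * (K ^ 2 * (2 * (X ^ 2 + Y ^ 2))) := by
        rw [mul_pow]; gcongr; exact add_sq_le
    _ = 8 * (|lam| + 1) * K ^ 2 * (X ^ 2 + Y ^ 2) := by ring
    _ ≤ (K + 8 * (|lam| + 1) * K ^ 2) * (X ^ 2 + Y ^ 2) := by
        gcongr; exact le_add_of_nonneg_left hK.le

end Estimates

theorem exists_forall_le_mul_of_eventually {ι : Type*} {y z : ι → ℝ} {C : ℝ} (hC : 0 ≤ C)
    (hz : ∀ n, 0 ≤ z n) (hy : ∀ n, z n = 0 → y n ≤ 0) (h : ∀ᶠ n in cofinite, y n ≤ C * z n) :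
    ∃ C', C ≤ C' ∧ ∀ n, y n ≤ C' * z n := by
  have hfin : {n | ¬ y n ≤ C * z n}.Finite := h
  refine ⟨C + ∑ n ∈ hfin.toFinset, |y n / z n|, le_add_of_nonneg_right (by positivity),
    fun n => ?_⟩
  by_cases hn : y n ≤ C * z n
  · exact hn.trans (mul_le_mul_of_nonneg_right (le_add_of_nonneg_right (by positivity)) (hz n))
  rcases (hz n).eq_or_lt with hzn | hzn
  · simpa [← hzn] using hy n hzn.symm
  · rw [← div_le_iff₀ hzn]
    calc y n / z n ≤ |y n / z n| := le_abs_self _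
      _ ≤ ∑ n ∈ hfin.toFinset, |y n / z n| :=
        Finset.single_le_sum (f := fun n => |y n / z n|) (fun _ _ => abs_nonneg _)
          (hfin.mem_toFinset.2 hn)
      _ ≤ C + ∑ n ∈ hfin.toFinset, |y n / z n| := le_add_of_nonneg_left hC

end StokesLPS

end

open StokesLPS in
theorem theorem4p2_general (Ω : Set Plane) (hΩ : IsBoundedLipschitzDomain Ω) (lam : ℝ) :
    (∃ C δ : ℝ, 0 < C ∧ 0 < δ ∧
      ∀ (u : Velocity Ω) (p : L2 Ω), IsStokesEigen u p lam →
      ∀ (uh : Velocity Ω) (lamh : ℝ), rForm uh uh ≤ 1 →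
      ∀ (ut : Velocity Ω) (pt : L2 Ω), IsStokesSource lamh uh ut pt →
        norm1 (u - ut) + ‖p - pt‖ ≤ C * (normNeg1 (u - uh) + |lam - lamh|) ∧
        (normNeg1 (u - uh) + |lam - lamh| ≤ δ →
          ut ≠ 0 ∧
          |rayleigh ut - lam| ≤ C * (normNeg1 (u - uh) ^ 2 + |lam - lamh| ^ 2))) ∧
    (∀ (u : Velocity Ω) (p : L2 Ω), IsStokesEigen u p lam →
      ∀ (uh : ℕ → Velocity Ω) (lamh : ℕ → ℝ), (∀ n, rForm (uh n) (uh n) ≤ 1) →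
        Tendsto (fun n => normNeg1 (u - uh n)) atTop (𝓝 0) →
        Tendsto lamh atTop (𝓝 lam) →
      ∀ (ut : ℕ → Velocity Ω) (pt : ℕ → L2 Ω),
        (∀ n, IsStokesSource (lamh n) (uh n) (ut n) (pt n)) →
        ∃ C : ℝ, 0 < C ∧ ∀ n,
          norm1 (u - ut n) + ‖p - pt n‖ ≤ C * (normNeg1 (u - uh n) + |lam - lamh n|) ∧
          (ut n ≠ 0 →
            |rayleigh (ut n) - lam| ≤
              C * (normNeg1 (u - uh n) ^ 2 + |lam - lamh n| ^ 2))) := by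
  obtain ⟨P, hP0, hP⟩ := exists_poincareInequality hΩ.isBounded
  obtain ⟨β, hβ0, hβ⟩ := exists_infSupCondition hΩ
  obtain ⟨C, δ, hC, hδ, h⟩ := exists_error_constants hΩ.isBounded hP0 hβ0 hP hβ lam
  refine ⟨⟨C, δ, hC, hδ, h⟩, fun u p hu uh lamh huh htu htlam ut pt hut => ?_⟩
  set z : ℕ → ℝ := fun n => normNeg1 (u - uh n) ^ 2 + |lam - lamh n| ^ 2
  have hn n := h u p hu (uh n) (lamh n) (huh n) (ut n) (pt n) (hut n)
  have hlim : Tendsto (fun n => normNeg1 (u - uh n) + |lam - lamh n|) atTop (𝓝 0) := by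
    simpa using htu.add (htlam.const_sub lam).abs
  have hexact n (hz : z n = 0) : |rayleigh (ut n) - lam| ≤ 0 := by
    obtain ⟨hX, hY⟩ := (add_eq_zero_iff_of_nonneg (sq_nonneg _) (sq_nonneg _)).1 hz
    have hs : normNeg1 (u - uh n) + |lam - lamh n| ≤ δ := by
      rw [pow_eq_zero_iff two_ne_zero] at hX hY
      rw [hX, hY, add_zero]
      exact hδ.le
    calc |rayleigh (ut n) - lam| ≤ C * z n := ((hn n).2 hs).2
      _ = 0 := by rw [hz, mul_zero]
  have hclose : ∀ᶠ n in cofinite, |rayleigh (ut n) - lam| ≤ C * z n := by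
    rw [Nat.cofinite_eq_atTop]
    exact (hlim.eventually_le_const hδ).mono fun n hs => ((hn n).2 hs).2
  obtain ⟨C', hCC', hC'⟩ :=
    exists_forall_le_mul_of_eventually hC.le (fun n => by positivity) hexact hclose
  refine ⟨C', hC.trans_le hCC', fun n => ⟨(hn n).1.trans ?_, fun _ => hC' n⟩⟩
  gcongr
  exact add_nonneg (normNeg1_nonneg _) (abs_nonneg _)

open StokesLPS in
theorem theorem4p2 (Ω : Set Plane) (hΩ : IsBoundedLipschitzDomain Ω) (lam : ℝ) :
    (∃ C δ : ℝ, 0 < C ∧ 0 < δ ∧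
      ∀ (u : Velocity Ω) (p : L2 Ω), IsStokesEigen u p lam →
      ∀ (D : Discretization Ω) (uh : Velocity Ω) (ph : D.Vh) (lamh : ℝ), D.IsEigen uh ph lamh →
      ∀ (ut : Velocity Ω) (pt : L2 Ω), IsStokesSource lamh uh ut pt →
        norm1 (u - ut) + ‖p - pt‖ ≤ C * (normNeg1 (u - uh) + |lam - lamh|) ∧
        (normNeg1 (u - uh) + |lam - lamh| ≤ δ →
          ut ≠ 0 ∧
          |rayleigh ut - lam| ≤ C * (normNeg1 (u - uh) ^ 2 + |lam - lamh| ^ 2))) ∧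
    (∀ (u : Velocity Ω) (p : L2 Ω), IsStokesEigen u p lam →
      ∀ (D : ℕ → Discretization Ω) (uh : ℕ → Velocity Ω) (ph : ∀ n, (D n).Vh) (lamh : ℕ → ℝ),
        (∀ n, (D n).IsEigen (uh n) (ph n) (lamh n)) →
        Tendsto (fun n => normNeg1 (u - uh n)) atTop (𝓝 0) →
        Tendsto lamh atTop (𝓝 lam) →
      ∀ (ut : ℕ → Velocity Ω) (pt : ℕ → L2 Ω),
        (∀ n, IsStokesSource (lamh n) (uh n) (ut n) (pt n)) →
        ∃ C : ℝ, 0 < C ∧ ∀ n,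
          norm1 (u - ut n) + ‖p - pt n‖ ≤ C * (normNeg1 (u - uh n) + |lam - lamh n|) ∧
          (ut n ≠ 0 →
            |rayleigh (ut n) - lam| ≤
              C * (normNeg1 (u - uh n) ^ 2 + |lam - lamh n| ^ 2))) := by
  obtain ⟨⟨C, δ, hC, hδ, ha⟩, hb⟩ := theorem4p2_general Ω hΩ lam
  exact ⟨⟨C, δ, hC, hδ, fun u p h _ uh _ lamh hh => ha u p h uh lamh hh.normalized.le⟩,
    fun u p h _ uh _ lamh hh => hb u p h uh lamh fun n => (hh n).normalized.le⟩
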